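/- Let $d\in\mathbb N$, $T\in(0,\infty]$, $\mathcal O_T=(0,T)\times\mathbb R^d$. For $X=(t,x)$, $Y=(s,y)$ in $\mathbb R\times\mathbb R^d$ put $\delta(X,Y)=\max\{|x-y|,|t-s|^{1/2}\}$ and $Q_c(X)=\{Y:\delta(X,Y)<c\}$. Let $|\cdot|$ also denote Lebesgue measure on $\mathbb R^{d+1}$. A set $D\subset\mathbb R^{d+1}$ is called $A$-type, with constant $A>0$, if $|D\cap Q_\rho(X)|\ge A\,|Q_\rho(X)|$ for all $X\in D$ and all $0<\rho\le\operatorname{diam}D$ (diameter with respect to $\delta$). For a jointly measurable random field $h$, $p\ge1$, $\theta\ge0$, the stochastic Campanato seminorm is $$[h]_{\mathscr L^{p,\theta}((D;\delta);L^p(\Omega))}=\Big(\sup_{X\in D,\;c>0}\frac1{|Q|^{1+\theta}}\,\mathbb E\int_Q\int_Q|h(Y)-h(Z)|^p\,dZ\,dY\Big)^{1/p},\qquad Q=D\cap Q_c(X).$$ Let $W$ be a standard one-dimensional Brownian motion on a probability space, defined for all finite times $t\in[0,T]$. For deterministic $K,g:\mathbb R\times\mathbb R^d\to\mathbb R$,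 the stochastic convolution is $$\mathcal Kg(t,x)=\int_0^t\int_{\mathbb R^d}K(t-r,y)\,g(r,x-y)\,dy\,dW(r),\qquad (t,x)\in\mathcal O_T,$$ the stochastic integral being the $L^2(\Omega)$-limit of integrals of deterministic step functions. **Theorem 2.1.** Let $p\ge1$, $0<\beta<1$, $\gamma_1,\gamma_2>0$, and let $N_0,N_1,N_2,C_g\geq 0$, $A>0$, $R>0$ be constants. Put $\gamma=\min\{\gamma_1,\gamma_2,\beta\}$ and $\theta=1+\frac{\gamma p}{d+2}$. There is a finite constant $N$, depending only on $d,T,p,\beta,\gamma_1,\gamma_2,N_0,N_1,N_2,C_g,A,R$, such that the following holds. Let $K$ be a measurable deterministic kernel such that for all finite $t\in(0,T]$ and all $0\le s<t$ $$\int_0^s\Big(\int_{\mathbb R^d}|K(t-r,z)-K(s-r,z)|(1+|z|^\beta)\,dz\Big)^2dr\le N_1(t-s)^{\gamma_1},\tag{2.2}$$ $$\int_0^s\Big(\int_{\mathbb R^d}|K(s-r,z)|\,dz\Big)^2dr\le N_0,\tag{2.3}$$ $$\int_s^t\Big(\int_{\mathbb R^d}|K(t-r,z)|(1+|z|^\beta)\,dz\Big)^2dr\le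 N_2(t-s)^{\gamma_2}.\tag{2.4}$$ Let $g$ be deterministic with $g(0,0)=0$ and $|g(X)-g(Y)|\le C_g\,\delta(X,Y)^\beta$ for all $X,Y\in[0,\infty)\times\mathbb R^d$. Then $\mathcal Kg$ is well defined on $\mathcal O_T$ (for every $(t,x)\in\mathcal O_T$ the inner integral converges absolutely for almost every $r\in(0,t)$ and is square integrable in $r$ over $(0,t)$) and has a jointly measurable version; and for every such version and every $A$-type domain (with constant $A$) $D\subset\mathbb R^{d+1}$ with $D\subset\{(t,x):|t|\le R,\ |x|\le R\}$ and $\overline D\subset\mathcal O_T$, $$[\mathcal Kg]_{\mathscr L^{p,\theta}((D;\delta);L^p(\Omega))}\le N.$$ -/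

import Mathlib

open MeasureTheory ProbabilityTheory Filter Topology Set
open scoped NNReal ENNReal

namespace StochConv

noncomputable section

/-- Space-time `ℝ × ℝ^d`; a point is `X = (t, x)`, and `volume` is Lebesgue measure on `ℝ^{d+1}`. -/
abbrev SpaceTime (d : ℕ) : Type := ℝ × EuclideanSpace ℝ (Fin d)

/-- The parabolic distance `δ(X, Y) = max {|x - y|, |t - s|^{1/2}}`. -/
def pdist {d : ℕ} (X Y : SpaceTime d) : ℝ :=
  max ‖X.2 - Y.2‖ (Real.sqrt |X.1 - Y.1|)

/-- The parabolic ball `Q_c(X) = {Y : δ(X, Y) < c}`. -/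
def pball {d : ℕ} (X : SpaceTime d) (c : ℝ) : Set (SpaceTime d) :=
  {Y | pdist X Y < c}

/-- The diameter of `D` with respect to the parabolic distance. -/
def pdiam {d : ℕ} (D : Set (SpaceTime d)) : ℝ≥0∞ :=
  ⨆ X ∈ D, ⨆ Y ∈ D, ENNReal.ofReal (pdist X Y)

/-- `𝒪_T = (0, T) × ℝ^d`, where `T ∈ (0, ∞]`. -/
def timeStrip (d : ℕ) (T : ℝ≥0∞) : Set (SpaceTime d) :=
  {X | 0 < X.1 ∧ ENNReal.ofReal X.1 < T}

/-- `D` is `A`-type with constant `A`: `|D ∩ Q_ρ(X)| ≥ A |Q_ρ(X)|` for all `X ∈ D` and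
`0 < ρ ≤ diam D`. -/
def IsATypeWith {d : ℕ} (A : ℝ≥0) (D : Set (SpaceTime d)) : Prop :=
  0 < A ∧ ∀ X ∈ D, ∀ ρ : ℝ, 0 < ρ → ENNReal.ofReal ρ ≤ pdiam D →
    A * volume (pball X ρ) ≤ volume (D ∩ pball X ρ)

/-- `g` is Hölder continuous of exponent `β` on `[0, ∞) × ℝ^d` with respect to the parabolic
distance, with Hölder constant `C`. -/
def IsPHolderWith {d : ℕ} (C : ℝ≥0) (β : ℝ) (g : SpaceTime d → ℝ) : Prop :=
  ∀ X Y : SpaceTime d, 0 ≤ X.1 → 0 ≤ Y.1 → |g X - g Y| ≤ C * pdist X Y ^ β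

/-- The three bounds on the kernel, for all `0 ≤ s < t ≤ T` (with `t < ∞`). -/
structure KernelBounds {d : ℕ} (T : ℝ≥0∞) (β γ₁ γ₂ : ℝ) (N₀ N₁ N₂ : ℝ≥0)
    (K : SpaceTime d → ℝ) : Prop where
  increment : ∀ s t : ℝ, 0 ≤ s → s < t → ENNReal.ofReal t ≤ T →
    ∫⁻ r in Ioo 0 s, (∫⁻ z : EuclideanSpace ℝ (Fin d),
        ‖K (t - r, z) - K (s - r, z)‖ₑ * ENNReal.ofReal (1 + ‖z‖ ^ β)) ^ 2
      ≤ N₁ * ENNReal.ofReal ((t - s) ^ γ₁)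
  bound : ∀ s t : ℝ, 0 ≤ s → s < t → ENNReal.ofReal t ≤ T →
    ∫⁻ r in Ioo 0 s, (∫⁻ z : EuclideanSpace ℝ (Fin d), ‖K (s - r, z)‖ₑ) ^ 2 ≤ N₀
  tail : ∀ s t : ℝ, 0 ≤ s → s < t → ENNReal.ofReal t ≤ T →
    ∫⁻ r in Ioo s t, (∫⁻ z : EuclideanSpace ℝ (Fin d),
        ‖K (t - r, z)‖ₑ * ENNReal.ofReal (1 + ‖z‖ ^ β)) ^ 2
      ≤ N₂ * ENNReal.ofReal ((t - s) ^ γ₂)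

section Wiener

variable {Ω : Type*} [MeasurableSpace Ω]

/-- `W` is a standard one-dimensional Brownian motion (Wiener process) on the time interval
`{t : 0 ≤ t ≤ T, t < ∞}`, where `T ∈ (0, ∞]`. -/
structure IsWienerProcess (T : ℝ≥0∞) (W : ℝ≥0 → Ω → ℝ) (P : Measure Ω) : Prop where
  zero : ∀ᵐ ω ∂P, W 0 ω = 0
  indep : HasIndepIncrements (fun t : {t : ℝ≥0 // (t : ℝ≥0∞) ≤ T} ↦ W t) P
  gaussian : ∀ s t : ℝ≥0, s ≤ t → (t : ℝ≥0∞) ≤ T →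
    HasLaw (fun ω ↦ W t ω - W s ω) (gaussianReal 0 (t - s)) P
  cont : ∀ᵐ ω ∂P, ContinuousOn (fun t : ℝ≥0 ↦ W t ω) {t : ℝ≥0 | (t : ℝ≥0∞) ≤ T}

/-- A deterministic step function `∑ i, c_i 1_{(a_i, b_i]}` with `0 ≤ a_i ≤ b_i ≤ t`. -/
structure StepFunction (t : ℝ) where
  n : ℕ
  left : Fin n → ℝ≥0
  right : Fin n → ℝ≥0
  coeff : Fin n → ℝ
  left_le_right : ∀ i, left i ≤ right i
  right_le : ∀ i, (right i : ℝ) ≤ t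

/-- The value of a step function at time `r`. -/
def StepFunction.eval {t : ℝ} (F : StepFunction t) (r : ℝ) : ℝ :=
  ∑ i, (Ioc (F.left i : ℝ) (F.right i)).indicator (fun _ ↦ F.coeff i) r

/-- The elementary stochastic integral `∑ i, c_i (W_{b_i} - W_{a_i})`. -/
def StepFunction.integral {t : ℝ} (F : StepFunction t) (W : ℝ≥0 → Ω → ℝ) (ω : Ω) : ℝ :=
  ∑ i, F.coeff i * (W (F.right i) ω - W (F.left i) ω)

/-- `ξ` is (a version of) the stochastic integral `∫_0^t f(r) dW(r)` of the deterministic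
square integrable function `f`: the limit in `L²(Ω)` of the elementary integrals of step
functions that converge to `f` in `L²(0, t)`. -/
def IsWienerIntegral (W : ℝ≥0 → Ω → ℝ) (P : Measure Ω) (t : ℝ) (f : ℝ → ℝ) (ξ : Ω → ℝ) : Prop :=
  MemLp f 2 (volume.restrict (Ioc 0 t)) ∧ MemLp ξ 2 P ∧
    ∃ F : ℕ → StepFunction t,
      Tendsto (fun n ↦ eLpNorm (fun r ↦ f r - (F n).eval r) 2 (volume.restrict (Ioc 0 t)))
        atTop (𝓝 0) ∧
      Tendsto (fun n ↦ eLpNorm (fun ω ↦ ξ ω - (F n).integral W ω) 2 P) atTop (𝓝 0)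

/-- `u` is a jointly measurable version, on `𝒪_T`, of the stochastic convolution
`𝒦g(t, x) = ∫_0^t ∫ K(t - r, y) g(r, x - y) dy dW(r)`. The inner integral is required to
converge absolutely for almost every `r ∈ (0, t)`. -/
structure IsStochasticConvolution {d : ℕ} (T : ℝ≥0∞) (K g : SpaceTime d → ℝ)
    (W : ℝ≥0 → Ω → ℝ) (P : Measure Ω) (u : SpaceTime d → Ω → ℝ) : Prop where
  measurable : Measurable (fun q : SpaceTime d × Ω ↦ u q.1 q.2)
  inner_integrable : ∀ X ∈ timeStrip d T, ∀ᵐ r ∂(volume.restrict (Ioc 0 X.1)),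
    Integrable (fun y : EuclideanSpace ℝ (Fin d) ↦ K (X.1 - r, y) * g (r, X.2 - y))
  version : ∀ X ∈ timeStrip d T, IsWienerIntegral W P X.1
    (fun r ↦ ∫ y : EuclideanSpace ℝ (Fin d), K (X.1 - r, y) * g (r, X.2 - y)) (u X)

/-- The stochastic Campanato seminorm `[h]_{ℒ^{p,θ}((D;δ);L^p(Ω))}`, that is, the `p`-th root of
`sup_Q |Q|^{-(1+θ)} 𝔼 ∫_Q ∫_Q |h(Y) - h(Z)|^p dZ dY`
over all `Q = D ∩ Q_c(X)` with `X ∈ D` and `c > 0`. -/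
def campanatoSeminorm {d : ℕ} (p θ : ℝ) (D : Set (SpaceTime d)) (P : Measure Ω)
    (h : SpaceTime d → Ω → ℝ) : ℝ≥0∞ :=
  (⨆ X ∈ D, ⨆ c ∈ Ioi (0 : ℝ),
    (∫⁻ ω, (∫⁻ Y in D ∩ pball X c, ∫⁻ Z in D ∩ pball X c, ‖h Y ω - h Z ω‖ₑ ^ p) ∂P) /
      volume (D ∩ pball X c) ^ (1 + θ)) ^ (1 / p)

end Wiener

end

end StochConv

open StochConv

/-! The integral of a deterministic function against W is a centred Gaussian variable whose variance
is the squared L² norm of the integrand, so that norm controls all its moments. For s ≤ t the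
increment of 𝒦g between Y = (s, y) and X = (t, x) is a single such integral: its integrand is
`innerConv K g X` minus `innerConv K g Y` cut off at s (`IsWienerIntegral.sub_indicator`).

What remains is a deterministic L² estimate. On (s, t] the growth |g(r, x - z)| ≲ 1 + |z|^β and
`tail` give (t - s)^γ₂. On (0, s] one writes K_t g_x - K_s g_y = (K_t - K_s) g_x + K_s (g_x - g_y);
`increment` handles the first term, `bound` and the Hölder continuity of g the second. Since |t - s|
≤ δ(X, Y)², the squared norm is ≲ δ^(2γ) on bounded sets (`exists_eLpNorm_innerConv_sub_le`), so the
p-th moment of the increment is ≲ δ^(γp).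

On Q = D ∩ Q_c(X) the A-type condition supplies a radius ρ with diam Q ≤ 2ρ and |Q| ≳ ρ^(d+2), which
turns δ^(γp) into |Q|^(γp/(d+2)), the power that the Campanato normalisation requires
(`campanatoSeminorm_le`). For existence, the second-moment estimate makes X ↦ 𝒦g(X) continuous into
L²(Ω), and such a map has a jointly measurable version (`exists_measurable_version`). -/

namespace StochConv

/-! ### Gaussian law of elementary stochastic integrals -/

section WienerIsometry

variable {Ω : Type*} [MeasurableSpace Ω] {P : Measure Ω} {T : ℝ≥0∞} {W : ℝ≥0 → Ω → ℝ}

lemma IsWienerProcess.hasLaw_eval (hW : IsWienerProcess T W P) {t : ℝ≥0} (ht : (t : ℝ≥0∞) ≤ T) :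
    HasLaw (W t) (gaussianReal 0 t) P := by
  have h := hW.gaussian 0 t zero_le ht
  rw [tsub_zero] at h
  refine h.congr ?_
  filter_upwards [hW.zero] with ω hω
  simp [hω]

lemma IsWienerProcess.isGaussianProcess (hW : IsWienerProcess T W P) :
    IsGaussianProcess (fun t : {t : ℝ≥0 // (t : ℝ≥0∞) ≤ T} ↦ W t) P := by
  let _ : OrderBot {t : ℝ≥0 // (t : ℝ≥0∞) ≤ T} :=
    { bot := ⟨0, by simp⟩, bot_le := fun _ ↦ Subtype.mk_le_mk.2 zero_le }
  exact HasIndepIncrements.isGaussianProcess (fun t ↦ (hW.hasLaw_eval t.2).hasGaussianLaw)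
    hW.zero hW.indep

lemma IsWienerProcess.memLp_two (hW : IsWienerProcess T W P) {t : ℝ≥0} (ht : (t : ℝ≥0∞) ≤ T) :
    MemLp (W t) 2 P :=
  (hW.hasLaw_eval ht).hasGaussianLaw.memLp_two

lemma IsWienerProcess.variance_eval (hW : IsWienerProcess T W P) {t : ℝ≥0}
    (ht : (t : ℝ≥0∞) ≤ T) : Var[W t; P] = t := by
  rw [(hW.hasLaw_eval ht).variance_eq, variance_id_gaussianReal]

/-- Polarization: expand the known variance t - s of the increment and solve for the cross term. -/
lemma IsWienerProcess.covariance_of_le [IsProbabilityMeasure P] (hW : IsWienerProcess T W P)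
    {s t : ℝ≥0} (hst : s ≤ t) (ht : (t : ℝ≥0∞) ≤ T) : cov[W s, W t; P] = s := by
  have hs : (s : ℝ≥0∞) ≤ T := (ENNReal.coe_le_coe.2 hst).trans ht
  have h1 : Var[fun ω ↦ W t ω - W s ω; P] = (t - s : ℝ≥0) := by
    rw [(hW.gaussian s t hst ht).variance_eq, variance_id_gaussianReal]
  have h2 := variance_fun_sub (hW.memLp_two ht) (hW.memLp_two hs)
  rw [h1, hW.variance_eval ht, hW.variance_eval hs, NNReal.coe_sub hst, covariance_comm] at h2
  linarith

lemma IsWienerProcess.covariance_eval [IsProbabilityMeasure P] (hW : IsWienerProcess T W P)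
    {s t : ℝ≥0} (hs : (s : ℝ≥0∞) ≤ T) (ht : (t : ℝ≥0∞) ≤ T) :
    cov[W s, W t; P] = min (s : ℝ) t := by
  rcases le_total s t with h | h
  · rw [hW.covariance_of_le h ht, min_eq_left (by exact_mod_cast h)]
  · rw [covariance_comm, hW.covariance_of_le h hs, min_eq_right (by exact_mod_cast h)]

/-- The Gram matrix in L² of the indicators of (0, τ_i] is min(τ_i, τ_j), the covariance matrix of
Brownian motion. This coincidence is the Itô isometry. -/
lemma integral_sq_sum_indicator {ι : Type*} [Fintype ι] {t : ℝ} (τ : ι → ℝ≥0)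
    (hτ : ∀ i, (τ i : ℝ) ≤ t) (e : ι → ℝ) :
    ∫ r in Ioc 0 t, (∑ i, e i * (Ioc 0 (τ i : ℝ)).indicator 1 r) ^ 2 =
      ∑ i, ∑ j, e i * (e j * min (τ i : ℝ) (τ j)) := by
  have key : ∀ i j, ∀ r : ℝ, e i * (Ioc 0 (τ i : ℝ)).indicator 1 r *
      (e j * (Ioc 0 (τ j : ℝ)).indicator 1 r) =
      (Ioc 0 (min (τ i : ℝ) (τ j))).indicator (fun _ ↦ e i * e j) r := by
    intro i j r
    simp only [indicator, mem_Ioc, le_min_iff, Pi.one_apply]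
    split_ifs <;> first | (exfalso; tauto) | ring
  have hint : ∀ i j, Integrable ((Ioc 0 (min (τ i : ℝ) (τ j))).indicator (fun _ ↦ e i * e j))
      (volume.restrict (Ioc 0 t)) := fun i j ↦
    (integrable_const _).indicator measurableSet_Ioc
  simp_rw [sq, Finset.sum_mul_sum, key]
  rw [integral_finsetSum _ fun i _ ↦ integrable_finsetSum _ fun j _ ↦ hint i j]
  refine Finset.sum_congr rfl fun i _ ↦ ?_
  rw [integral_finsetSum _ fun j _ ↦ hint i j]
  refine Finset.sum_congr rfl fun j _ ↦ ?_
  rw [integral_indicator measurableSet_Ioc, Measure.restrict_restrict measurableSet_Ioc,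
    inter_eq_self_of_subset_left (Ioc_subset_Ioc_right ((min_le_left _ _).trans (hτ i)))]
  simp
  ring

lemma IsWienerProcess.hasLaw_sum [IsProbabilityMeasure P] (hW : IsWienerProcess T W P)
    {ι : Type*} [Fintype ι] {t : ℝ} (τ : ι → ℝ≥0) (hτT : ∀ i, (τ i : ℝ≥0∞) ≤ T)
    (hτ : ∀ i, (τ i : ℝ) ≤ t) (e : ι → ℝ) :
    HasLaw (fun ω ↦ ∑ i, e i * W (τ i) ω) (gaussianReal 0
      (∫ r in Ioc 0 t, (∑ i, e i * (Ioc 0 (τ i : ℝ)).indicator 1 r) ^ 2).toNNReal) P := by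
  classical
  -- The times may repeat, so the Gaussian vector is indexed by the finset of distinct times and the
  -- sum is a linear form in its coordinates.
  have hG := hW.isGaussianProcess.hasGaussianLaw (Finset.univ.image fun i ↦ ⟨τ i, hτT i⟩)
  have hG' := hG.map (∑ i, e i • ContinuousLinearMap.proj
    (⟨⟨τ i, hτT i⟩, Finset.mem_image_of_mem _ (Finset.mem_univ i)⟩ :
      (Finset.univ.image fun i ↦ (⟨τ i, hτT i⟩ : {t : ℝ≥0 // (t : ℝ≥0∞) ≤ T}) : Finset _)))
  have hG'' : HasGaussianLaw (fun ω ↦ ∑ i, e i * W (τ i) ω) P := by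
    refine hG'.congr (ae_of_all _ fun ω ↦ ?_)
    simp [sum_apply]
  refine ⟨hG''.aemeasurable, ?_⟩
  have hm : ∀ i, MemLp (fun ω ↦ e i * W (τ i) ω) 2 P := fun i ↦
    (hW.memLp_two (hτT i)).const_mul _
  rw [hG''.map_eq_gaussianReal, ← covariance_self hG''.aemeasurable,
    covariance_fun_sum_fun_sum hm hm, integral_sq_sum_indicator τ hτ]
  congr 1
  · rw [integral_finsetSum _ fun i _ ↦ (hm i).integrable one_le_two]
    refine Finset.sum_eq_zero fun i _ ↦ ?_
    rw [integral_const_mul, (hW.hasLaw_eval (hτT i)).integral_eq, integral_id_gaussianReal,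
      mul_zero]
  · congr 1
    refine Finset.sum_congr rfl fun i _ ↦ Finset.sum_congr rfl fun j _ ↦ ?_
    rw [covariance_const_mul_left, covariance_const_mul_right,
      hW.covariance_eval (hτT i) (hτT j)]

/-- Each interval contributes its right endpoint with weight c and its left endpoint with weight -c,
which brings step functions into the form treated by `IsWienerProcess.hasLaw_sum`. -/
lemma StepFunction.integral_eq_sum {t : ℝ} {Ω' : Type*} (F : StepFunction t)
    (W : ℝ≥0 → Ω' → ℝ) (ω : Ω') :
    F.integral W ω = ∑ i : Fin F.n ⊕ Fin F.n, Sum.elim F.coeff (fun i ↦ -F.coeff i) i *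
      W (Sum.elim F.right F.left i) ω := by
  simp [StepFunction.integral, mul_sub, Finset.sum_sub_distrib, ← sub_eq_add_neg]

lemma StepFunction.eval_eq_sum {t : ℝ} (F : StepFunction t) {r : ℝ} (hr : 0 < r) :
    F.eval r = ∑ i : Fin F.n ⊕ Fin F.n, Sum.elim F.coeff (fun i ↦ -F.coeff i) i *
      (Ioc 0 ((Sum.elim F.right F.left i : ℝ≥0) : ℝ)).indicator 1 r := by
  simp only [StepFunction.eval, Fintype.sum_sum_type, Sum.elim_inl, Sum.elim_inr,
    ← Finset.sum_add_distrib]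
  refine Finset.sum_congr rfl fun i _ ↦ ?_
  have := NNReal.coe_le_coe.2 (F.left_le_right i)
  by_cases h1 : r ≤ F.left i <;> by_cases h2 : r ≤ F.right i
  · simp [indicator, hr, h1, h2]
  · linarith
  · simp [indicator, hr, h1, h2, not_le.1 h1]
  · simp [indicator, hr, h1, h2]

lemma IsWienerProcess.hasLaw_stepFunction [IsProbabilityMeasure P] (hW : IsWienerProcess T W P)
    {t : ℝ} (ht : ENNReal.ofReal t ≤ T) (F : StepFunction t) :
    HasLaw (F.integral W) (gaussianReal 0 (∫ r in Ioc 0 t, F.eval r ^ 2).toNNReal) P := by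
  have hle : ∀ i, ((Sum.elim F.right F.left i : ℝ≥0) : ℝ) ≤ t := by
    rintro (i | i)
    · exact F.right_le i
    · exact (NNReal.coe_le_coe.2 (F.left_le_right i)).trans (F.right_le i)
  have hT : ∀ i, ((Sum.elim F.right F.left i : ℝ≥0) : ℝ≥0∞) ≤ T := fun i ↦ by
    refine le_trans ?_ ht
    rw [← ENNReal.ofReal_coe_nnreal]
    exact ENNReal.ofReal_le_ofReal (hle i)
  have h := hW.hasLaw_sum _ hT hle (Sum.elim F.coeff fun i ↦ -F.coeff i)
  rw [setIntegral_congr_fun (g := fun r ↦ F.eval r ^ 2) measurableSet_Ioc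
    fun r hr ↦ by simp only [F.eval_eq_sum hr.1]] at h
  exact h.congr (ae_of_all _ fun ω ↦ F.integral_eq_sum W ω)

lemma StepFunction.measurable_eval {t : ℝ} (F : StepFunction t) : Measurable F.eval :=
  Finset.measurable_fun_sum _ fun _ _ ↦ measurable_const.indicator measurableSet_Ioc

lemma StepFunction.memLp_eval {t : ℝ} (F : StepFunction t) (p : ℝ≥0∞) :
    MemLp F.eval p (volume.restrict (Ioc 0 t)) :=
  memLp_finsetSum _ fun _ _ ↦ (memLp_const _).indicator measurableSet_Ioc

lemma eLpNorm_gaussianReal_zero (p : ℝ≥0∞) (v : ℝ≥0) :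
    eLpNorm id p (gaussianReal 0 v) =
      ENNReal.ofReal (Real.sqrt v) * eLpNorm id p (gaussianReal 0 1) := by
  have h := gaussianReal_map_const_mul (μ := 0) (v := 1) (Real.sqrt v)
  have hv : NNReal.mk (Real.sqrt v ^ 2) (sq_nonneg _) * 1 = v := by
    ext; simp
  rw [hv, mul_zero] at h
  rw [← h, eLpNorm_map_measure aestronglyMeasurable_id (by fun_prop)]
  have : (id ∘ fun x : ℝ ↦ Real.sqrt v * x) = Real.sqrt v • (id : ℝ → ℝ) := by
    ext; simp
  rw [this, eLpNorm_const_smul, Real.enorm_eq_ofReal (Real.sqrt_nonneg _)]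

/-- Gaussian isometry: all moments of an elementary integral are controlled by the `L²` norm of
the integrand. -/
lemma IsWienerProcess.eLpNorm_stepFunction [IsProbabilityMeasure P] (hW : IsWienerProcess T W P)
    {t : ℝ} (ht : ENNReal.ofReal t ≤ T) (F : StepFunction t) (p : ℝ≥0∞) :
    eLpNorm (F.integral W) p P =
      eLpNorm id p (gaussianReal 0 1) * eLpNorm F.eval 2 (volume.restrict (Ioc 0 t)) := by
  have h := hW.hasLaw_stepFunction ht F
  have h1 : eLpNorm (F.integral W) p P = eLpNorm id p (P.map (F.integral W)) := by
    rw [eLpNorm_map_measure aestronglyMeasurable_id h.aemeasurable, Function.id_comp]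
  rw [h1, h.map_eq, eLpNorm_gaussianReal_zero, mul_comm]
  congr 1
  rw [(F.memLp_eval 2).eLpNorm_eq_integral_rpow_norm two_ne_zero ENNReal.ofNat_ne_top]
  have h0 : 0 ≤ ∫ r in Ioc 0 t, F.eval r ^ 2 := integral_nonneg fun r ↦ sq_nonneg _
  simp [Real.coe_toNNReal _ h0, Real.sqrt_eq_rpow]

lemma eLpNorm_id_gaussianReal_ne_top {p : ℝ≥0∞} (hp : p ≠ ∞) :
    eLpNorm id p (gaussianReal 0 1) ≠ ∞ :=
  (memLp_id_gaussianReal' p hp).eLpNorm_ne_top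

end WienerIsometry

/-! ### Wiener integrals: differences, moments, existence -/

section WienerIntegral

lemma StepFunction.exists_sub {t : ℝ} {Ω : Type*} (W : ℝ≥0 → Ω → ℝ) (F G : StepFunction t) :
    ∃ H : StepFunction t, (∀ r, H.eval r = F.eval r - G.eval r) ∧
      ∀ ω, H.integral W ω = F.integral W ω - G.integral W ω := by
  refine ⟨⟨F.n + G.n, Fin.append F.left G.left, Fin.append F.right G.right,
    Fin.append F.coeff (fun i ↦ -G.coeff i), fun i ↦ ?_, fun i ↦ ?_⟩, fun r ↦ ?_, fun ω ↦ ?_⟩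
  · refine Fin.addCases (fun i ↦ ?_) (fun i ↦ ?_) i
    · simpa using F.left_le_right i
    · simpa using G.left_le_right i
  · refine Fin.addCases (fun i ↦ ?_) (fun i ↦ ?_) i
    · simpa using F.right_le i
    · simpa using G.right_le i
  · have : ∀ (s : Set ℝ) (c : ℝ), s.indicator (fun _ ↦ -c) r = -s.indicator (fun _ ↦ c) r :=
      fun s c ↦ by by_cases h : r ∈ s <;> simp [h]
    simp [StepFunction.eval, Fin.sum_univ_add, sub_eq_add_neg, this]
  · simp [StepFunction.integral, Fin.sum_univ_add, sub_eq_add_neg]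

lemma StepFunction.exists_extend {s t : ℝ} {Ω : Type*} (W : ℝ≥0 → Ω → ℝ) (hst : s ≤ t)
    (F : StepFunction s) :
    ∃ H : StepFunction t, (∀ r, H.eval r = F.eval r) ∧ ∀ ω, H.integral W ω = F.integral W ω :=
  ⟨⟨F.n, F.left, F.right, F.coeff, F.left_le_right, fun i ↦ (F.right_le i).trans hst⟩,
    fun _ ↦ rfl, fun _ ↦ rfl⟩

lemma StepFunction.eval_eq_zero {s : ℝ} (F : StepFunction s) {r : ℝ} (hr : s < r) :
    F.eval r = 0 :=
  Finset.sum_eq_zero fun i _ ↦ indicator_of_notMem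
    (fun h ↦ absurd (h.2.trans (F.right_le i)) (not_le.2 hr)) _

lemma eLpNorm_indicator_sub_eval {s t : ℝ} (hst : s ≤ t) (f : ℝ → ℝ) (F : StepFunction s)
    (p : ℝ≥0∞) :
    eLpNorm (fun r ↦ (Ioc 0 s).indicator f r - F.eval r) p (volume.restrict (Ioc 0 t)) =
      eLpNorm (fun r ↦ f r - F.eval r) p (volume.restrict (Ioc 0 s)) := by
  have h : volume.restrict (Ioc 0 s) = (volume.restrict (Ioc 0 t)).restrict (Ioc 0 s) := by
    rw [Measure.restrict_restrict measurableSet_Ioc,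
      inter_eq_self_of_subset_left (Ioc_subset_Ioc_right hst)]
  rw [h, ← eLpNorm_indicator_eq_eLpNorm_restrict (f := fun r ↦ f r - F.eval r)
    (measurableSet_Ioc : MeasurableSet (Ioc 0 s))]
  refine eLpNorm_congr_ae ((ae_restrict_mem measurableSet_Ioc).mono fun r hr ↦ ?_)
  by_cases h : r ≤ s
  · have hr' : r ∈ Ioc 0 s := ⟨hr.1, h⟩
    simp only [indicator_of_mem hr']
  · have hr' : r ∉ Ioc 0 s := fun h' ↦ h h'.2
    simp only [indicator_of_notMem hr', F.eval_eq_zero (not_le.1 h), sub_zero]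

variable {Ω : Type*} [MeasurableSpace Ω] {P : Measure Ω} {T : ℝ≥0∞} {W : ℝ≥0 → Ω → ℝ}

lemma IsWienerProcess.memLp_stepFunction [IsProbabilityMeasure P] (hW : IsWienerProcess T W P)
    {t : ℝ} (ht : ENNReal.ofReal t ≤ T) (F : StepFunction t) {p : ℝ≥0∞} (hp : p ≠ ∞) :
    MemLp (F.integral W) p P := by
  refine ⟨(hW.hasLaw_stepFunction ht F).aemeasurable.aestronglyMeasurable, ?_⟩
  rw [hW.eLpNorm_stepFunction ht]
  exact ENNReal.mul_lt_top (eLpNorm_id_gaussianReal_ne_top hp).lt_top (F.memLp_eval 2).2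

/-- A step function on (0, s] is one on (0, t] that vanishes after s, with the same elementary
integral; hence approximations of the two integrals can be subtracted. -/
lemma IsWienerIntegral.sub_indicator [IsProbabilityMeasure P] (hW : IsWienerProcess T W P)
    {s t : ℝ} (hst : s ≤ t) (ht : ENNReal.ofReal t ≤ T) {f g : ℝ → ℝ} {ξ η : Ω → ℝ}
    (hf : IsWienerIntegral W P t f ξ) (hg : IsWienerIntegral W P s g η) :
    IsWienerIntegral W P t (fun r ↦ f r - (Ioc 0 s).indicator g r) (fun ω ↦ ξ ω - η ω) := by
  obtain ⟨hf₁, hf₂, F, hF₁, hF₂⟩ := hf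
  obtain ⟨hg₁, hg₂, G, hG₁, hG₂⟩ := hg
  choose G' hG'₁ hG'₂ using fun n ↦ (G n).exists_extend W hst
  choose H hH₁ hH₂ using fun n ↦ (F n).exists_sub W (G' n)
  have hg' : MemLp ((Ioc 0 s).indicator g) 2 (volume.restrict (Ioc 0 t)) := by
    rw [memLp_indicator_iff_restrict measurableSet_Ioc,
      Measure.restrict_restrict measurableSet_Ioc,
      inter_eq_self_of_subset_left (Ioc_subset_Ioc_right hst)]
    exact hg₁
  have hsT : ENNReal.ofReal s ≤ T := (ENNReal.ofReal_le_ofReal hst).trans ht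
  refine ⟨hf₁.sub hg', hf₂.sub hg₂, H, ?_, ?_⟩
  · refine tendsto_of_tendsto_of_tendsto_of_le_of_le tendsto_const_nhds
      (by simpa using hF₁.add hG₁) (fun _ ↦ zero_le) fun n ↦ ?_
    calc _ = eLpNorm ((fun r ↦ f r - (F n).eval r) -
          fun r ↦ (Ioc 0 s).indicator g r - (G n).eval r) 2 (volume.restrict (Ioc 0 t)) := by
          congr 1; ext r; simp [hH₁, hG'₁]; ring
      _ ≤ _ := by
          refine (eLpNorm_sub_le (hf₁.1.sub ((F n).memLp_eval 2).1)
            (hg'.1.sub (G n).measurable_eval.aestronglyMeasurable) one_le_two).trans ?_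
          exact add_le_add le_rfl (eLpNorm_indicator_sub_eval hst _ _ _).le
  · refine tendsto_of_tendsto_of_tendsto_of_le_of_le tendsto_const_nhds
      (by simpa using hF₂.add hG₂) (fun _ ↦ zero_le) fun n ↦ ?_
    calc _ = eLpNorm ((fun ω ↦ ξ ω - (F n).integral W ω) -
          fun ω ↦ η ω - (G n).integral W ω) 2 P := by
          congr 1; ext r; simp [hH₂, hG'₂]; ring
      _ ≤ _ := eLpNorm_sub_le (hf₂.1.sub (hW.memLp_stepFunction ht _ (ENNReal.ofNat_ne_top (n := 2))).1)
          (hg₂.1.sub (hW.memLp_stepFunction hsT _ (ENNReal.ofNat_ne_top (n := 2))).1) one_le_two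

/-- The moments of a Wiener integral are controlled by the `L²` norm of the integrand. -/
lemma IsWienerIntegral.eLpNorm_le [IsProbabilityMeasure P] (hW : IsWienerProcess T W P)
    {t : ℝ} (ht : ENNReal.ofReal t ≤ T) {f : ℝ → ℝ} {ξ : Ω → ℝ}
    (hf : IsWienerIntegral W P t f ξ) {p : ℝ≥0∞} (hp : p ≠ ∞) :
    eLpNorm ξ p P ≤
      eLpNorm id p (gaussianReal 0 1) * eLpNorm f 2 (volume.restrict (Ioc 0 t)) := by
  obtain ⟨hf₁, hξ, F, hF, hFξ⟩ := hf
  have hm := fun n ↦ (hW.memLp_stepFunction ht (F n) ENNReal.ofNat_ne_top (p := 2)).1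
  -- The approximation converges only in L²(Ω), which does not suffice for larger p. An a.e.
  -- convergent subsequence and lower semicontinuity of the p-norm (Fatou) transfer the bound.
  have hlim : TendstoInMeasure P (fun n ↦ (F n).integral W) atTop ξ := by
    refine tendstoInMeasure_of_tendsto_eLpNorm two_ne_zero hm hξ.1 ?_
    simp_rw [eLpNorm_sub_comm _ ξ]
    exact hFξ
  obtain ⟨ns, hns, hae⟩ := hlim.exists_seq_tendsto_ae
  set m := eLpNorm id p (gaussianReal 0 1)
  have hmt : m ≠ ∞ := eLpNorm_id_gaussianReal_ne_top hp
  have hbound : ∀ n, eLpNorm ((F n).integral W) p P ≤ m * (eLpNorm f 2 (volume.restrict (Ioc 0 t)) +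
      eLpNorm (fun r ↦ f r - (F n).eval r) 2 (volume.restrict (Ioc 0 t))) := fun n ↦ by
    rw [hW.eLpNorm_stepFunction ht]
    gcongr
    calc _ = eLpNorm (f - fun r ↦ f r - (F n).eval r) 2 (volume.restrict (Ioc 0 t)) := by
          congr 1; ext; simp
      _ ≤ _ := eLpNorm_sub_le hf₁.1 (hf₁.1.sub ((F n).memLp_eval 2).1) one_le_two
  refine (Lp.eLpNorm_lim_le_liminf_eLpNorm (fun n ↦ hm (ns n)) ξ hae).trans ?_
  refine (liminf_le_liminf (Eventually.of_forall fun n ↦ hbound (ns n))).trans_eq ?_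
  refine Tendsto.liminf_eq ?_
  have := ENNReal.Tendsto.const_mul (a := m)
    ((tendsto_const_nhds (x := eLpNorm f 2 (volume.restrict (Ioc 0 t)))).add
      (hF.comp hns.tendsto_atTop)) (Or.inr hmt)
  simpa using this

lemma exists_stepFunction_forall_abs_sub_le {t : ℝ} (ht : 0 < t) {g : ℝ → ℝ}
    (hg : UniformContinuous g) {ε : ℝ} (hε : 0 < ε) :
    ∃ F : StepFunction t, ∀ r ∈ Ioc 0 t, |g r - F.eval r| ≤ ε := by
  obtain ⟨δ, hδ, hgδ⟩ := Metric.uniformContinuous_iff.1 hg ε hε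
  obtain ⟨n, hn⟩ := exists_nat_gt (t / δ)
  have hn0 : 0 < (n : ℝ) := (div_pos ht hδ).trans hn
  have hh : 0 < t / n := div_pos ht hn0
  have hl : ∀ i : Fin n, ((i : ℝ) * (t / n)).toNNReal ≤ (((i : ℝ) + 1) * (t / n)).toNNReal :=
    fun i ↦ Real.toNNReal_le_toNNReal (by gcongr; linarith)
  have hrt : ∀ i : Fin n, ((((i : ℝ) + 1) * (t / n)).toNNReal : ℝ) ≤ t := by
    intro i
    have : ((i : ℕ) : ℝ) + 1 ≤ n := by exact_mod_cast i.2
    rw [Real.coe_toNNReal _ (by positivity)]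
    calc _ ≤ n * (t / n) := by gcongr
      _ = t := by field_simp
  refine ⟨⟨n, _, _, fun i ↦ g ((i + 1) * (t / n)), hl, hrt⟩, fun r hr ↦ ?_⟩
  · have hpos : 0 < r / (t / n) := div_pos hr.1 hh
    have hc1 := Nat.ceil_lt_add_one hpos.le
    have hc2 := Nat.le_ceil (r / (t / n))
    have hc0 : 0 < ⌈r / (t / n)⌉₊ := Nat.ceil_pos.2 hpos
    have hcn : ⌈r / (t / n)⌉₊ ≤ n := Nat.ceil_le.2 (by
      rw [div_le_iff₀ hh]
      calc r ≤ t := hr.2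
        _ = n * (t / n) := by field_simp)
    set k := ⌈r / (t / n)⌉₊ with hk
    -- The cells (i t/n, (i+1) t/n] are open on the left, so r lies in the cell whose index is the
    -- ceiling of r/(t/n) minus one.
    obtain ⟨j, hj⟩ : ∃ j : ℕ, k = j + 1 := ⟨k - 1, by omega⟩
    have hjk : (k : ℝ) = j + 1 := by exact_mod_cast hj
    have hmem : ∀ i : Fin n, r ∈ Ioc ((i : ℝ) * (t / n)) ((i + 1) * (t / n)) ↔ (i : ℕ) = j := by
      intro i
      rw [mem_Ioc, ← lt_div_iff₀ hh, ← div_le_iff₀ hh]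
      constructor
      · rintro ⟨h1, h2⟩
        have h3 : ((i : ℕ) : ℝ) < j + 1 := by linarith
        have h4 : (j : ℝ) < (i : ℕ) + 1 := by linarith
        have h3' : (i : ℕ) < j + 1 := by exact_mod_cast h3
        have h4' : j < (i : ℕ) + 1 := by exact_mod_cast h4
        omega
      · intro h
        rw [h]
        constructor <;> linarith
    have heval : StepFunction.eval (t := t) ⟨n, _, _, fun i ↦ g ((i + 1) * (t / n)), hl, hrt⟩ r =
        g ((j + 1) * (t / n)) := by
      have hjn : j < n := by omega
      simp only [StepFunction.eval]
      rw [Finset.sum_eq_single ⟨j, hjn⟩]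
      · rw [Real.coe_toNNReal _ (by positivity), Real.coe_toNNReal _ (by positivity),
          indicator_of_mem ((hmem ⟨j, hjn⟩).2 rfl)]
      · intro i _ hi
        rw [Real.coe_toNNReal _ (by positivity), Real.coe_toNNReal _ (by positivity),
          indicator_of_notMem]
        rw [hmem]
        exact fun h ↦ hi (Fin.ext h)
      · simp
    rw [heval]
    refine (hgδ ?_).le
    have h1 : r ≤ (j + 1) * (t / n) := by rw [← div_le_iff₀ hh]; linarith
    have h2 : j * (t / n) < r := by rw [← lt_div_iff₀ hh]; linarith
    have h3 : t / n < δ := by rw [div_lt_iff₀ hn0, mul_comm]; exact (div_lt_iff₀ hδ).1 hn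
    rw [Real.dist_eq, abs_lt]
    constructor <;> nlinarith

/-- Step functions are dense in `L²(0, t)`. -/
lemma exists_stepFunction_eLpNorm_sub_le {t : ℝ} {f : ℝ → ℝ}
    (hf : MemLp f 2 (volume.restrict (Ioc 0 t))) {ε : ℝ≥0∞} (hε : ε ≠ 0) :
    ∃ F : StepFunction t,
      eLpNorm (fun r ↦ f r - F.eval r) 2 (volume.restrict (Ioc 0 t)) ≤ ε := by
  rcases le_or_gt t 0 with ht | ht
  · refine ⟨⟨0, Fin.elim0, Fin.elim0, Fin.elim0, fun i ↦ i.elim0, fun i ↦ i.elim0⟩, ?_⟩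
    simp [Ioc_eq_empty (not_lt.2 ht)]
  obtain ⟨g, hgc, hfg, hg, hg2⟩ :=
    hf.exists_hasCompactSupport_eLpNorm_sub_le ENNReal.ofNat_ne_top (ENNReal.half_pos hε).ne'
  -- V converts a uniform error on (0, t] into an L² error.
  set V := (volume.restrict (Ioc 0 t)) univ ^ (ENNReal.toReal 2)⁻¹ with hV
  have hVt : V ≠ ∞ := ENNReal.rpow_ne_top_of_nonneg (by simp) (by simp)
  obtain ⟨η, hη, hηε⟩ : ∃ η : ℝ, 0 < η ∧ V * ENNReal.ofReal η ≤ ε / 2 := by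
    have h : Tendsto (fun η : ℝ ↦ V * ENNReal.ofReal η) (𝓝[>] 0) (𝓝 0) := by
      have := ENNReal.Tendsto.const_mul (a := V)
        (ENNReal.continuous_ofReal.tendsto (0 : ℝ)) (Or.inr hVt)
      simpa using this.mono_left nhdsWithin_le_nhds
    obtain ⟨η, h1, h2⟩ := ((h.eventually_le_const (ENNReal.half_pos hε)).and
      self_mem_nhdsWithin).exists
    exact ⟨η, h2, h1⟩
  obtain ⟨F, hF⟩ := exists_stepFunction_forall_abs_sub_le ht
    (hgc.uniformContinuous_of_continuous hg) hη
  refine ⟨F, ?_⟩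
  calc _ = eLpNorm ((f - g) + (g - F.eval)) 2 (volume.restrict (Ioc 0 t)) := by
        congr 1; ext; simp
    _ ≤ _ := eLpNorm_add_le (hf.1.sub hg2.1) (hg2.1.sub (F.memLp_eval 2).1) one_le_two
    _ ≤ ε / 2 + ε / 2 := by
        gcongr
        refine (eLpNorm_le_of_ae_bound
          ((ae_restrict_mem measurableSet_Ioc).mono fun r hr ↦ ?_)).trans hηε
        simpa using hF r hr
    _ = ε := ENNReal.add_halves ε

lemma exists_isWienerIntegral [IsProbabilityMeasure P] (hW : IsWienerProcess T W P)
    {t : ℝ} (ht : ENNReal.ofReal t ≤ T) {f : ℝ → ℝ}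
    (hf : MemLp f 2 (volume.restrict (Ioc 0 t))) : ∃ ξ, IsWienerIntegral W P t f ξ := by
  have hpow : ∀ n : ℕ, (2⁻¹ : ℝ≥0∞) ^ n ≠ 0 := fun n ↦ pow_ne_zero _ (by simp)
  choose F hF using fun n : ℕ ↦ exists_stepFunction_eLpNorm_sub_le hf (hpow n)
  set m := eLpNorm id 2 (gaussianReal 0 1)
  have hmt : m ≠ ∞ := eLpNorm_id_gaussianReal_ne_top ENNReal.ofNat_ne_top
  have hF0 : Tendsto (fun n ↦ eLpNorm (fun r ↦ f r - (F n).eval r) 2 (volume.restrict (Ioc 0 t)))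
      atTop (𝓝 0) :=
    tendsto_of_tendsto_of_tendsto_of_le_of_le tendsto_const_nhds
      (ENNReal.tendsto_pow_atTop_nhds_zero_of_lt_one (by simp [ENNReal.inv_lt_one]))
      (fun _ ↦ zero_le) hF
  have hmem := fun n ↦ hW.memLp_stepFunction ht (F n) ENNReal.ofNat_ne_top (p := 2)
  -- Two approximation errors of size 2⁻ᴺ give the factor m * 2; the extra 1 makes the Cauchy bound
  -- strict.
  have hsum : ∑' N : ℕ, (m * 2 + 1) * 2⁻¹ ^ N ≠ ∞ := by
    rw [ENNReal.tsum_mul_left, ENNReal.tsum_geometric]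
    simp [ENNReal.mul_eq_top, hmt]
  have hcau : ∀ N i j : ℕ, N ≤ i → N ≤ j →
      eLpNorm ((F i).integral W - (F j).integral W) 2 P < (m * 2 + 1) * 2⁻¹ ^ N := by
    intro N i j hi hj
    obtain ⟨H, hH₁, hH₂⟩ := (F i).exists_sub W (F j)
    have h1 : (F i).integral W - (F j).integral W = H.integral W := by ext ω; simp [hH₂]
    rw [h1, hW.eLpNorm_stepFunction ht]
    have hp : ∀ i, N ≤ i → (2⁻¹ : ℝ≥0∞) ^ i ≤ 2⁻¹ ^ N := fun i hi ↦
      pow_le_pow_right_of_le_one' (by simp) hi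
    have h2 : eLpNorm H.eval 2 (volume.restrict (Ioc 0 t)) ≤ 2 * 2⁻¹ ^ N := by
      calc _ = eLpNorm ((fun r ↦ f r - (F j).eval r) - fun r ↦ f r - (F i).eval r) 2
            (volume.restrict (Ioc 0 t)) := by congr 1; ext r; simp [hH₁]
        _ ≤ _ := eLpNorm_sub_le (hf.1.sub ((F j).memLp_eval 2).1)
              (hf.1.sub ((F i).memLp_eval 2).1) one_le_two
        _ ≤ 2⁻¹ ^ N + 2⁻¹ ^ N := add_le_add ((hF j).trans (hp j hj)) ((hF i).trans (hp i hi))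
        _ = _ := (two_mul _).symm
    have htop : (2⁻¹ : ℝ≥0∞) ^ N ≠ ∞ := ENNReal.pow_ne_top (by simp)
    calc _ ≤ m * (2 * 2⁻¹ ^ N) := by gcongr
      _ < m * (2 * 2⁻¹ ^ N) + 2⁻¹ ^ N :=
          ENNReal.lt_add_right (ENNReal.mul_ne_top hmt (ENNReal.mul_ne_top (by simp) htop)) (hpow N)
      _ = _ := by ring
  obtain ⟨ξ, hξ, hlim⟩ := Lp.cauchy_complete_eLpNorm one_le_two hmem hsum hcau
  refine ⟨ξ, hf, hξ, F, hF0, ?_⟩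
  simp_rw [eLpNorm_sub_comm _ ξ] at hlim
  exact hlim

end WienerIntegral

/-! ### Jointly measurable versions -/

/-- A strongly measurable map into `L²` has a jointly measurable version. -/
lemma exists_measurable_version {E Ω : Type*} [MeasurableSpace E] [MeasurableSpace Ω]
    {P : Measure Ω} {f : E → Lp ℝ 2 P} (hf : StronglyMeasurable f) :
    ∃ u : E → Ω → ℝ, Measurable (fun q : E × Ω ↦ u q.1 q.2) ∧ ∀ x, u x =ᵐ[P] f x := by
  rcases isEmpty_or_nonempty E with hE | hE
  · exact ⟨fun _ _ ↦ 0, measurable_const, fun x ↦ hE.elim x⟩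
  let _ : MeasurableSpace (Lp ℝ 2 P) := borel _
  have : BorelSpace (Lp ℝ 2 P) := ⟨rfl⟩
  have : Nonempty (range f) := (range_nonempty f).to_subtype
  have := hf.isSeparable_range.separableSpace
  set e : ℕ → Lp ℝ 2 P := fun k ↦ (TopologicalSpace.denseSeq (range f) k : Lp ℝ 2 P)
  have hdense : ∀ (n : ℕ) (x : E), ∃ k, dist (f x) (e k) < (2⁻¹ : ℝ) ^ n := fun n x ↦ by
    obtain ⟨k, hk⟩ := (TopologicalSpace.denseRange_denseSeq (range f)).exists_dist_lt
      ⟨f x, mem_range_self x⟩ (ε := (2⁻¹ : ℝ) ^ n) (by positivity)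
    exact ⟨k, hk⟩
  classical
  -- Taking the first point of the dense sequence within 2⁻ⁿ discretizes f measurably: the choice
  -- takes countably many values, so `v n` is jointly measurable.
  set N : ℕ → E → ℕ := fun n x ↦ Nat.find (hdense n x)
  have hN : ∀ n x, dist (f x) (e (N n x)) < (2⁻¹ : ℝ) ^ n := fun n x ↦ Nat.find_spec (hdense n x)
  have hNm : ∀ n, Measurable (N n) := fun n ↦ measurable_find (hdense n) fun k ↦
    measurableSet_lt (hf.dist stronglyMeasurable_const).measurable measurable_const
  set v : ℕ → E × Ω → ℝ := fun n q ↦ e (N n q.1) q.2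
  have hv : ∀ n, Measurable (v n) := fun n ↦ by
    have : Measurable (fun q : Ω × ℕ ↦ (e q.2 : Ω → ℝ) q.1) :=
      measurable_from_prod_countable_left fun k ↦ (Lp.stronglyMeasurable (e k)).measurable
    exact this.comp (measurable_snd.prodMk ((hNm n).comp measurable_fst))
  -- The limsup is measurable whether or not the sequence converges. Summable L² errors give a.e.
  -- convergence, and a subsequence identifies the limit as `f x`.
  refine ⟨fun x ω ↦ limsup (fun n ↦ v n (x, ω)) atTop, Measurable.limsup hv, fun x ↦ ?_⟩
  have hle : ∀ n, eLpNorm ((e (N n x) : Ω → ℝ) - (f x : Ω → ℝ)) 2 P ≤ 2⁻¹ ^ n := by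
    intro n
    rw [← Lp.edist_def, edist_dist, dist_comm]
    refine (ENNReal.ofReal_le_ofReal (hN n x).le).trans_eq ?_
    rw [ENNReal.ofReal_pow (by norm_num), ENNReal.ofReal_inv_of_pos two_pos,
      ENNReal.ofReal_ofNat]
  have hcau : ∀ M i j : ℕ, M ≤ i → M ≤ j →
      eLpNorm ((e (N i x) : Ω → ℝ) - (e (N j x) : Ω → ℝ)) 2 P < 3 * 2⁻¹ ^ M := by
    intro M i j hi hj
    have hp : ∀ i, M ≤ i → (2⁻¹ : ℝ≥0∞) ^ i ≤ 2⁻¹ ^ M := fun i hi ↦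
      pow_le_pow_right_of_le_one' (by simp) hi
    calc _ = eLpNorm (((e (N i x) : Ω → ℝ) - (f x : Ω → ℝ)) -
          ((e (N j x) : Ω → ℝ) - (f x : Ω → ℝ))) 2 P := by congr 1; abel
      _ ≤ _ := eLpNorm_sub_le ((Lp.aestronglyMeasurable _).sub (Lp.aestronglyMeasurable _))
          ((Lp.aestronglyMeasurable _).sub (Lp.aestronglyMeasurable _)) one_le_two
      _ ≤ 2⁻¹ ^ M + 2⁻¹ ^ M :=
          add_le_add ((hle i).trans (hp i hi)) ((hle j).trans (hp j hj))
      _ = 2 * 2⁻¹ ^ M := (two_mul _).symm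
      _ < 3 * 2⁻¹ ^ M := by
          refine (ENNReal.mul_lt_mul_iff_left (by simp) (ENNReal.pow_ne_top (by simp))).2 ?_
          norm_num
  have hsum : ∑' M : ℕ, (3 * 2⁻¹ ^ M : ℝ≥0∞) ≠ ∞ := by
    rw [ENNReal.tsum_mul_left, ENNReal.tsum_geometric]
    simp [ENNReal.mul_eq_top]
  have hmeas : ∀ n, AEStronglyMeasurable (e (N n x) : Ω → ℝ) P := fun n ↦
    Lp.aestronglyMeasurable _
  have hae := Lp.ae_tendsto_of_cauchy_eLpNorm hmeas one_le_two hsum hcau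
  have hlim : TendstoInMeasure P (fun n ↦ (e (N n x) : Ω → ℝ)) atTop (f x) := by
    refine tendstoInMeasure_of_tendsto_eLpNorm two_ne_zero hmeas (Lp.aestronglyMeasurable _) ?_
    exact tendsto_of_tendsto_of_tendsto_of_le_of_le tendsto_const_nhds
      (ENNReal.tendsto_pow_atTop_nhds_zero_of_lt_one (by simp [ENNReal.inv_lt_one])) (fun _ ↦ zero_le) hle
  obtain ⟨ns, hns, hae'⟩ := hlim.exists_seq_tendsto_ae
  filter_upwards [hae, hae'] with ω ⟨l, hl⟩ hl'
  have : l = f x ω := tendsto_nhds_unique (hl.comp hns.tendsto_atTop) hl'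
  rw [← this]
  exact hl.limsup_eq

/-! ### L² estimates for the inner convolution -/

section InnerConvolution

variable {d : ℕ}

lemma continuous_pdist : Continuous (fun q : SpaceTime d × SpaceTime d ↦ pdist q.1 q.2) := by
  unfold pdist
  fun_prop

lemma pdist_self (X : SpaceTime d) : pdist X X = 0 := by simp [pdist]

lemma pdist_nonneg (X Y : SpaceTime d) : 0 ≤ pdist X Y := le_max_of_le_left (norm_nonneg _)

lemma pdist_comm (X Y : SpaceTime d) : pdist X Y = pdist Y X := by
  simp [pdist, norm_sub_rev, abs_sub_comm]

lemma abs_sub_le_pdist_sq (X Y : SpaceTime d) : |X.1 - Y.1| ≤ pdist X Y ^ 2 :=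
  (Real.sqrt_le_left (pdist_nonneg X Y)).1 (le_max_right _ _)

lemma norm_sub_le_pdist (X Y : SpaceTime d) : ‖X.2 - Y.2‖ ≤ pdist X Y := le_max_left _ _

variable {C : ℝ≥0} {β : ℝ} {g : SpaceTime d → ℝ}

/-- Nothing is known about g at negative times, not even measurability. Clamping time at 0 gives a
globally continuous function that agrees with g wherever it is integrated. -/
lemma IsPHolderWith.continuous_clamp (hg : IsPHolderWith C β g) (hβ : 0 < β) :
    Continuous (fun X : SpaceTime d ↦ g (max X.1 0, X.2)) := by
  rw [continuous_iff_continuousAt]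
  intro X
  have hc : Continuous fun Y : SpaceTime d ↦
      (C : ℝ) * pdist (max Y.1 0, Y.2) (max X.1 0, X.2) ^ β := by
    refine continuous_const.mul (Continuous.rpow_const ?_ fun _ ↦ Or.inr hβ.le)
    exact continuous_pdist.comp
      (f := fun Y : SpaceTime d ↦ (((max Y.1 0, Y.2) : SpaceTime d), (max X.1 0, X.2))) (by fun_prop)
  have h0 := hc.tendsto X
  rw [pdist_self, Real.zero_rpow hβ.ne', mul_zero] at h0
  rw [ContinuousAt, tendsto_iff_norm_sub_tendsto_zero]
  exact squeeze_zero (fun _ ↦ norm_nonneg _)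
    (fun Y ↦ hg _ _ (le_max_right _ _) (le_max_right _ _)) h0

lemma IsPHolderWith.continuous_slice (hg : IsPHolderWith C β g) (hβ : 0 < β) {r : ℝ} (hr : 0 ≤ r)
    (x : EuclideanSpace ℝ (Fin d)) : Continuous (fun z ↦ g (r, x - z)) := by
  have := (hg.continuous_clamp hβ).comp
    (f := fun z : EuclideanSpace ℝ (Fin d) ↦ ((r, x - z) : SpaceTime d)) (by fun_prop)
  simpa [Function.comp_def, max_eq_left hr] using this

/-- Compare with g(0, 0) = 0. As R ≥ 1, both parts of the distance to the origin are at most R(1 +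
|z|), and u ↦ u^β is subadditive for β ≤ 1. This growth is the reason for the weight 1 + |z|^β. -/
lemma IsPHolderWith.abs_le (hg : IsPHolderWith C β g) (hg0 : g (0, 0) = 0) (hβ : 0 < β)
    (hβ' : β ≤ 1) {R r : ℝ} (hR : 1 ≤ R) (hr : 0 ≤ r) (hrR : r ≤ R)
    {x : EuclideanSpace ℝ (Fin d)} (hx : ‖x‖ ≤ R) (z : EuclideanSpace ℝ (Fin d)) :
    |g (r, x - z)| ≤ C * R ^ β * (1 + ‖z‖ ^ β) := by
  have h := hg (r, x - z) (0, 0) hr le_rfl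
  rw [hg0, sub_zero] at h
  have hδ : pdist (r, x - z) (0, 0) ≤ R * (1 + ‖z‖) := by
    have h0 := norm_nonneg z
    simp only [pdist, sub_zero, abs_of_nonneg hr]
    refine max_le ((norm_sub_le _ _).trans (by nlinarith)) ?_
    refine (Real.sqrt_le_iff.2 ⟨by positivity, ?_⟩)
    have : 1 ≤ R * (1 + ‖z‖) := by nlinarith
    nlinarith
  calc _ ≤ (C : ℝ) * pdist (r, x - z) (0, 0) ^ β := h
    _ ≤ C * (R * (1 + ‖z‖)) ^ β := by
        gcongr
        exact pdist_nonneg _ _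
    _ = C * R ^ β * (1 + ‖z‖) ^ β := by
        rw [Real.mul_rpow (by positivity) (by positivity), mul_assoc]
    _ ≤ C * R ^ β * (1 + ‖z‖ ^ β) := by
        gcongr
        simpa using Real.rpow_add_le_add_rpow zero_le_one (norm_nonneg z) hβ.le hβ'

lemma IsPHolderWith.enorm_le (hg : IsPHolderWith C β g) (hg0 : g (0, 0) = 0) (hβ : 0 < β)
    (hβ' : β ≤ 1) {R r : ℝ} (hR : 1 ≤ R) (hr : 0 ≤ r) (hrR : r ≤ R)
    {x : EuclideanSpace ℝ (Fin d)} (hx : ‖x‖ ≤ R) (z : EuclideanSpace ℝ (Fin d)) :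
    ‖g (r, x - z)‖ₑ ≤ ENNReal.ofReal (C * R ^ β) * ENNReal.ofReal (1 + ‖z‖ ^ β) := by
  rw [Real.enorm_eq_ofReal_abs, ← ENNReal.ofReal_mul (by positivity)]
  exact ENNReal.ofReal_le_ofReal (hg.abs_le hg0 hβ hβ' hR hr hrR hx z)

lemma IsPHolderWith.enorm_sub_le (hg : IsPHolderWith C β g) {r : ℝ} (hr : 0 ≤ r)
    (x y z : EuclideanSpace ℝ (Fin d)) :
    ‖g (r, x - z) - g (r, y - z)‖ₑ ≤ ENNReal.ofReal (C * ‖x - y‖ ^ β) := by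
  rw [Real.enorm_eq_ofReal_abs]
  refine ENNReal.ofReal_le_ofReal ((hg _ _ hr hr).trans_eq ?_)
  simp [pdist]

/-- The weighted mass `∫ |F(z)| (1 + |z|^β) dz`. -/
noncomputable def weightedMass (β : ℝ) (F : EuclideanSpace ℝ (Fin d) → ℝ) : ℝ≥0∞ :=
  ∫⁻ z, ‖F z‖ₑ * ENNReal.ofReal (1 + ‖z‖ ^ β)

/-- The inner integral `∫ K(t - r, y) g(r, x - y) dy`. -/
noncomputable def innerConv (K g : SpaceTime d → ℝ) (X : SpaceTime d) (r : ℝ) : ℝ :=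
  ∫ y, K (X.1 - r, y) * g (r, X.2 - y)

variable {K : SpaceTime d → ℝ}

lemma measurable_weightedMass (hβ : 0 ≤ β) {F : ℝ → EuclideanSpace ℝ (Fin d) → ℝ}
    (hF : Measurable (fun q : ℝ × EuclideanSpace ℝ (Fin d) ↦ F q.1 q.2)) :
    Measurable (fun r ↦ weightedMass β (F r)) := by
  refine Measurable.lintegral_prod_right' (f := fun q : ℝ × EuclideanSpace ℝ (Fin d) ↦
    ‖F q.1 q.2‖ₑ * ENNReal.ofReal (1 + ‖q.2‖ ^ β)) ?_
  refine hF.enorm.mul (Continuous.measurable ?_)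
  exact ENNReal.continuous_ofReal.comp (continuous_const.add
    (continuous_snd.norm.rpow_const fun _ ↦ Or.inr hβ))

lemma measurable_kernel_reflect (hK : Measurable K) (t : ℝ) :
    Measurable (fun q : ℝ × EuclideanSpace ℝ (Fin d) ↦ K (t - q.1, q.2)) :=
  hK.comp (by fun_prop)

lemma stronglyMeasurable_innerConv_clamp (hK : Measurable K) (hg : IsPHolderWith C β g)
    (hβ : 0 < β) (X : SpaceTime d) :
    StronglyMeasurable
      (innerConv K (fun Y : SpaceTime d ↦ g (max Y.1 0, Y.2)) X) := by
  refine StronglyMeasurable.integral_prod_right' (f := fun q : ℝ × EuclideanSpace ℝ (Fin d) ↦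
    K (X.1 - q.1, q.2) * g (max q.1 0, X.2 - q.2)) (Measurable.stronglyMeasurable ?_)
  refine (measurable_kernel_reflect hK X.1).mul ?_
  exact (hg.continuous_clamp hβ).measurable.comp
    (f := fun q : ℝ × EuclideanSpace ℝ (Fin d) ↦ ((q.1, X.2 - q.2) : SpaceTime d)) (by fun_prop)

lemma aestronglyMeasurable_innerConv (hK : Measurable K) (hg : IsPHolderWith C β g)
    (hβ : 0 < β) (X : SpaceTime d) (t : ℝ) :
    AEStronglyMeasurable (innerConv K g X) (volume.restrict (Ioc 0 t)) := by
  refine (stronglyMeasurable_innerConv_clamp hK hg hβ X).aestronglyMeasurable.congr ?_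
  refine (ae_restrict_mem measurableSet_Ioc).mono fun r hr ↦ ?_
  simp only [innerConv, max_eq_left hr.1.le]

lemma lintegral_mul_enorm_le (hg : IsPHolderWith C β g) (hg0 : g (0, 0) = 0) (hβ : 0 < β)
    (hβ' : β ≤ 1) {R r : ℝ} (hR : 1 ≤ R) (hr : 0 ≤ r) (hrR : r ≤ R)
    {x : EuclideanSpace ℝ (Fin d)} (hx : ‖x‖ ≤ R) (F : EuclideanSpace ℝ (Fin d) → ℝ) :
    ∫⁻ z, ‖F z * g (r, x - z)‖ₑ ≤ ENNReal.ofReal (C * R ^ β) * weightedMass β F := by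
  rw [weightedMass, ← lintegral_const_mul' _ _ ENNReal.ofReal_ne_top]
  refine lintegral_mono fun z ↦ ?_
  rw [enorm_mul, mul_left_comm]
  gcongr
  exact hg.enorm_le hg0 hβ hβ' hR hr hrR hx z

lemma integrable_mul_of_weightedMass (hg : IsPHolderWith C β g) (hg0 : g (0, 0) = 0) (hβ : 0 < β)
    (hβ' : β ≤ 1) {r : ℝ} (hr : 0 ≤ r) (x : EuclideanSpace ℝ (Fin d))
    {F : EuclideanSpace ℝ (Fin d) → ℝ} (hF : Measurable F) (hFm : weightedMass β F < ∞) :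
    Integrable (fun z ↦ F z * g (r, x - z)) := by
  refine ⟨(hF.mul (hg.continuous_slice hβ hr x).measurable).aestronglyMeasurable, ?_⟩
  refine (lintegral_mul_enorm_le hg hg0 hβ hβ' (R := max 1 (max r ‖x‖)) (le_max_left _ _) hr
    (le_max_of_le_right (le_max_left _ _)) (le_max_of_le_right (le_max_right _ _)) F).trans_lt ?_
  exact ENNReal.mul_lt_top ENNReal.ofReal_lt_top hFm

variable {T : ℝ≥0∞} {γ₁ γ₂ : ℝ} {N₀ N₁ N₂ : ℝ≥0}

lemma KernelBounds.tail_Ioc (hB : KernelBounds T β γ₁ γ₂ N₀ N₁ N₂ K) {s t : ℝ} (hs : 0 ≤ s)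
    (hst : s ≤ t) (ht : ENNReal.ofReal t ≤ T) :
    ∫⁻ r in Ioc s t, weightedMass β (fun z ↦ K (t - r, z)) ^ 2 ≤
      N₂ * ENNReal.ofReal ((t - s) ^ γ₂) := by
  rcases hst.eq_or_lt with rfl | hst
  · simp
  rw [← restrict_Ioo_eq_restrict_Ioc]
  exact hB.tail s t hs hst ht

lemma KernelBounds.increment_Ioc (hB : KernelBounds T β γ₁ γ₂ N₀ N₁ N₂ K) {s t : ℝ} (hs : 0 ≤ s)
    (hst : s ≤ t) (ht : ENNReal.ofReal t ≤ T) :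
    ∫⁻ r in Ioc 0 s, weightedMass β (fun z ↦ K (t - r, z) - K (s - r, z)) ^ 2 ≤
      N₁ * ENNReal.ofReal ((t - s) ^ γ₁) := by
  rcases hst.eq_or_lt with rfl | hst
  · simp [weightedMass]
  rw [← restrict_Ioo_eq_restrict_Ioc]
  exact hB.increment s t hs hst ht

/-- The field `bound` asks for a later finite time t ≤ T that its inequality does not involve;
density of the order provides one, also when T = ∞. -/
lemma KernelBounds.bound_Ioc (hB : KernelBounds T β γ₁ γ₂ N₀ N₁ N₂ K) {s : ℝ} (hs : 0 ≤ s)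
    (hsT : ENNReal.ofReal s < T) :
    ∫⁻ r in Ioc 0 s, (∫⁻ z, ‖K (s - r, z)‖ₑ) ^ 2 ≤ N₀ := by
  obtain ⟨c, hsc, hcT⟩ := exists_between hsT
  rw [← restrict_Ioo_eq_restrict_Ioc]
  refine hB.bound s c.toReal hs ?_ ?_
  · rwa [ENNReal.ofReal_lt_iff_lt_toReal hs hcT.ne_top] at hsc
  · rw [ENNReal.ofReal_toReal hcT.ne_top]
    exact hcT.le

/-- Apply `tail` from time 0: a function with finite integral is finite a.e. -/
lemma KernelBounds.ae_weightedMass_lt_top (hK : Measurable K) (hβ : 0 ≤ β)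
    (hB : KernelBounds T β γ₁ γ₂ N₀ N₁ N₂ K) {t : ℝ} (ht0 : 0 ≤ t) (ht : ENNReal.ofReal t ≤ T) :
    ∀ᵐ r ∂volume.restrict (Ioc 0 t), weightedMass β (fun z ↦ K (t - r, z)) < ∞ := by
  have h := ae_lt_top ((measurable_weightedMass hβ (measurable_kernel_reflect hK t)).pow_const 2)
    ((hB.tail_Ioc le_rfl ht0 ht).trans_lt
      (ENNReal.mul_lt_top ENNReal.coe_lt_top ENNReal.ofReal_lt_top)).ne
  exact h.mono fun r hr ↦ by simpa using hr

lemma ae_integrable_innerConv (hK : Measurable K) (hB : KernelBounds T β γ₁ γ₂ N₀ N₁ N₂ K)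
    (hg : IsPHolderWith C β g) (hg0 : g (0, 0) = 0) (hβ : 0 < β) (hβ' : β ≤ 1)
    {X : SpaceTime d} (hX : X ∈ timeStrip d T) :
    ∀ᵐ r ∂volume.restrict (Ioc 0 X.1), Integrable (fun y ↦ K (X.1 - r, y) * g (r, X.2 - y)) := by
  filter_upwards [hB.ae_weightedMass_lt_top hK hβ.le hX.1.le hX.2.le,
    ae_restrict_mem measurableSet_Ioc] with r hr hr'
  exact integrable_mul_of_weightedMass hg hg0 hβ hβ' hr'.1.le X.2 (hK.comp (by fun_prop)) hr

lemma enorm_innerConv_le (hg : IsPHolderWith C β g) (hg0 : g (0, 0) = 0) (hβ : 0 < β)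
    (hβ' : β ≤ 1) {R r : ℝ} (hR : 1 ≤ R) (hr : 0 ≤ r) (hrR : r ≤ R) {X : SpaceTime d}
    (hX : ‖X.2‖ ≤ R) :
    ‖innerConv K g X r‖ₑ ≤
      ENNReal.ofReal (C * R ^ β) * weightedMass β (fun z ↦ K (X.1 - r, z)) :=
  (enorm_integral_le_lintegral_enorm _).trans
    (lintegral_mul_enorm_le hg hg0 hβ hβ' hR hr hrR hX _)

lemma lintegral_innerConv_sq_le (hB : KernelBounds T β γ₁ γ₂ N₀ N₁ N₂ K)
    (hg : IsPHolderWith C β g) (hg0 : g (0, 0) = 0) (hβ : 0 < β) (hβ' : β ≤ 1)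
    {R : ℝ} (hR : 1 ≤ R) {X : SpaceTime d} (hXT : ENNReal.ofReal X.1 ≤ T) (hX₁ : X.1 ≤ R)
    (hX₂ : ‖X.2‖ ≤ R) {s : ℝ} (hs : 0 ≤ s) (hsX : s ≤ X.1) :
    ∫⁻ r in Ioc s X.1, ‖innerConv K g X r‖ₑ ^ 2 ≤
      ENNReal.ofReal (C * R ^ β) ^ 2 * (N₂ * ENNReal.ofReal ((X.1 - s) ^ γ₂)) := by
  calc _ ≤ ∫⁻ r in Ioc s X.1, ENNReal.ofReal (C * R ^ β) ^ 2 *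
        weightedMass β (fun z ↦ K (X.1 - r, z)) ^ 2 := by
        refine setLIntegral_mono' measurableSet_Ioc fun r hr ↦ ?_
        rw [← mul_pow]
        gcongr
        exact enorm_innerConv_le hg hg0 hβ hβ' hR (hs.trans hr.1.le) (hr.2.trans hX₁) hX₂
    _ ≤ _ := by
        rw [lintegral_const_mul' _ _ (ENNReal.pow_ne_top ENNReal.ofReal_ne_top)]
        gcongr
        exact hB.tail_Ioc hs hsX hXT

lemma memLp_two_iff_lintegral_sq {α : Type*} [MeasurableSpace α] {μ : Measure α} {f : α → ℝ}
    (hf : AEStronglyMeasurable f μ) : MemLp f 2 μ ↔ ∫⁻ a, ‖f a‖ₑ ^ 2 ∂μ < ∞ := by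
  simp [MemLp, hf, eLpNorm_lt_top_iff_lintegral_rpow_enorm_lt_top two_ne_zero
    ENNReal.ofNat_ne_top]

lemma memLp_innerConv (hK : Measurable K) (hB : KernelBounds T β γ₁ γ₂ N₀ N₁ N₂ K)
    (hg : IsPHolderWith C β g) (hg0 : g (0, 0) = 0) (hβ : 0 < β) (hβ' : β ≤ 1)
    {X : SpaceTime d} (hX : X ∈ timeStrip d T) :
    MemLp (innerConv K g X) 2 (volume.restrict (Ioc 0 X.1)) := by
  rw [memLp_two_iff_lintegral_sq (aestronglyMeasurable_innerConv hK hg hβ X X.1)]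
  refine (lintegral_innerConv_sq_le hB hg hg0 hβ hβ' (R := max 1 (max X.1 ‖X.2‖))
    (le_max_left _ _) hX.2.le (le_max_of_le_right (le_max_left _ _))
    (le_max_of_le_right (le_max_right _ _)) le_rfl hX.1.le).trans_lt ?_
  exact ENNReal.mul_lt_top (ENNReal.pow_lt_top ENNReal.ofReal_lt_top)
    (ENNReal.mul_lt_top ENNReal.coe_lt_top ENNReal.ofReal_lt_top)

lemma ae_enorm_innerConv_sub_le (hK : Measurable K) (hB : KernelBounds T β γ₁ γ₂ N₀ N₁ N₂ K)
    (hg : IsPHolderWith C β g) (hg0 : g (0, 0) = 0) (hβ : 0 < β) (hβ' : β ≤ 1)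
    {R : ℝ} (hR : 1 ≤ R) {X Y : SpaceTime d} (hX : X ∈ timeStrip d T) (hY : Y ∈ timeStrip d T)
    (hYX : Y.1 ≤ X.1) (hX₁ : X.1 ≤ R) (hX₂ : ‖X.2‖ ≤ R) :
    ∀ᵐ r ∂volume.restrict (Ioc 0 Y.1), ‖innerConv K g X r - innerConv K g Y r‖ₑ ≤
      ENNReal.ofReal (C * R ^ β) * weightedMass β (fun z ↦ K (X.1 - r, z) - K (Y.1 - r, z)) +
      ENNReal.ofReal (C * ‖X.2 - Y.2‖ ^ β) * ∫⁻ z, ‖K (Y.1 - r, z)‖ₑ := by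
  filter_upwards [ae_integrable_innerConv hK hB hg hg0 hβ hβ' hY,
    ae_mono (Measure.restrict_mono (Ioc_subset_Ioc_right hYX) le_rfl)
      (ae_integrable_innerConv hK hB hg hg0 hβ hβ' hX),
    ae_restrict_mem measurableSet_Ioc] with r hrY hrX hr
  rw [innerConv, innerConv, ← integral_sub hrX hrY]
  have hKm : Measurable fun z ↦ ‖K (Y.1 - r, z)‖ₑ := (hK.comp (by fun_prop)).enorm
  calc _ ≤ ∫⁻ z, ‖K (X.1 - r, z) * g (r, X.2 - z) - K (Y.1 - r, z) * g (r, Y.2 - z)‖ₑ :=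
        enorm_integral_le_lintegral_enorm _
    _ ≤ ∫⁻ z, (‖(K (X.1 - r, z) - K (Y.1 - r, z)) * g (r, X.2 - z)‖ₑ +
        ENNReal.ofReal (C * ‖X.2 - Y.2‖ ^ β) * ‖K (Y.1 - r, z)‖ₑ) := by
        refine lintegral_mono fun z ↦ ?_
        -- Only the kernel difference meets the growth of g and needs the weighted mass; the
        -- increment of g is bounded uniformly in z.
        have : K (X.1 - r, z) * g (r, X.2 - z) - K (Y.1 - r, z) * g (r, Y.2 - z) =
            (K (X.1 - r, z) - K (Y.1 - r, z)) * g (r, X.2 - z) +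
            (g (r, X.2 - z) - g (r, Y.2 - z)) * K (Y.1 - r, z) := by ring
        rw [this]
        refine (enorm_add_le _ _).trans ?_
        rw [enorm_mul (g (r, X.2 - z) - g (r, Y.2 - z))]
        gcongr
        exact hg.enorm_sub_le hr.1.le _ _ _
    _ = (∫⁻ z, ‖(K (X.1 - r, z) - K (Y.1 - r, z)) * g (r, X.2 - z)‖ₑ) +
        ENNReal.ofReal (C * ‖X.2 - Y.2‖ ^ β) * ∫⁻ z, ‖K (Y.1 - r, z)‖ₑ := by
        rw [lintegral_add_right _ (hKm.const_mul _),
          lintegral_const_mul' _ _ ENNReal.ofReal_ne_top]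
    _ ≤ _ := by
        gcongr
        exact lintegral_mul_enorm_le hg hg0 hβ hβ' hR hr.1.le (hr.2.trans (hYX.trans hX₁)) hX₂ _

lemma ennreal_add_sq_le (a b : ℝ≥0∞) : (a + b) ^ 2 ≤ 2 * (a ^ 2 + b ^ 2) := by
  have h := ENNReal.rpow_add_le_mul_rpow_add_rpow a b one_le_two
  norm_num at h
  exact h

lemma lintegral_innerConv_sub_sq_le (hK : Measurable K)
    (hB : KernelBounds T β γ₁ γ₂ N₀ N₁ N₂ K)
    (hg : IsPHolderWith C β g) (hg0 : g (0, 0) = 0) (hβ : 0 < β) (hβ' : β ≤ 1)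
    {R : ℝ} (hR : 1 ≤ R) {X Y : SpaceTime d} (hX : X ∈ timeStrip d T) (hY : Y ∈ timeStrip d T)
    (hYX : Y.1 ≤ X.1) (hX₁ : X.1 ≤ R) (hX₂ : ‖X.2‖ ≤ R) :
    ∫⁻ r in Ioc 0 Y.1, ‖innerConv K g X r - innerConv K g Y r‖ₑ ^ 2 ≤
      2 * (ENNReal.ofReal (C * R ^ β) ^ 2 * (N₁ * ENNReal.ofReal ((X.1 - Y.1) ^ γ₁))) +
      2 * (ENNReal.ofReal (C * ‖X.2 - Y.2‖ ^ β) ^ 2 * N₀) := by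
  have hm := measurable_weightedMass hβ.le (F := fun r z ↦ K (X.1 - r, z) - K (Y.1 - r, z))
    ((measurable_kernel_reflect hK _).sub (measurable_kernel_reflect hK _))
  have htop : ∀ a : ℝ, ENNReal.ofReal a ^ 2 ≠ ∞ := fun _ ↦ ENNReal.pow_ne_top ENNReal.ofReal_ne_top
  calc _ ≤ ∫⁻ r in Ioc 0 Y.1, (2 * (ENNReal.ofReal (C * R ^ β) ^ 2 *
          weightedMass β (fun z ↦ K (X.1 - r, z) - K (Y.1 - r, z)) ^ 2) +
        2 * (ENNReal.ofReal (C * ‖X.2 - Y.2‖ ^ β) ^ 2 * (∫⁻ z, ‖K (Y.1 - r, z)‖ₑ) ^ 2)) := by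
        refine lintegral_mono_ae ((ae_enorm_innerConv_sub_le hK hB hg hg0 hβ hβ' hR hX hY hYX hX₁
          hX₂).mono fun r hr ↦ (pow_le_pow_left' hr 2).trans ?_)
        rw [← mul_pow, ← mul_pow, ← mul_add]
        exact ennreal_add_sq_le _ _
    _ = _ := by
        rw [lintegral_add_left (((hm.pow_const 2).const_mul _).const_mul _),
          lintegral_const_mul' _ _ ENNReal.ofNat_ne_top, lintegral_const_mul' _ _ (htop _),
          lintegral_const_mul' _ _ ENNReal.ofNat_ne_top, lintegral_const_mul' _ _ (htop _)]
    _ ≤ _ := by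
        gcongr
        · exact hB.increment_Ioc hY.1.le hYX hX.2.le
        · exact hB.bound_Ioc hY.1.le hY.2

lemma lintegral_sub_indicator_sq {s t : ℝ} (hs : 0 ≤ s) (hst : s ≤ t) (f h : ℝ → ℝ) :
    ∫⁻ r in Ioc 0 t, ‖f r - (Ioc 0 s).indicator h r‖ₑ ^ 2 =
      (∫⁻ r in Ioc 0 s, ‖f r - h r‖ₑ ^ 2) + ∫⁻ r in Ioc s t, ‖f r‖ₑ ^ 2 := by
  rw [← Ioc_union_Ioc_eq_Ioc hs hst, lintegral_union measurableSet_Ioc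
    (Ioc_disjoint_Ioc_of_le le_rfl)]
  congr 1
  · exact setLIntegral_congr_fun measurableSet_Ioc fun r hr ↦ by simp only [indicator_of_mem hr]
  · refine setLIntegral_congr_fun measurableSet_Ioc fun r hr ↦ ?_
    simp only [indicator_of_notMem (fun h : r ∈ Ioc 0 s ↦ absurd h.2 (not_le.2 hr.1)), sub_zero]

lemma ennreal_combination_eq_ofReal (n₀ n₁ n₂ : ℝ≥0) {a b p q : ℝ} (ha : 0 ≤ a) (hb : 0 ≤ b)
    (hp : 0 ≤ p) (hq : 0 ≤ q) :
    2 * (ENNReal.ofReal a ^ 2 * (n₁ * ENNReal.ofReal p)) + 2 * (ENNReal.ofReal b ^ 2 * n₀) +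
        ENNReal.ofReal a ^ 2 * (n₂ * ENNReal.ofReal q) =
      ENNReal.ofReal (2 * (a ^ 2 * (n₁ * p)) + 2 * (b ^ 2 * n₀) + a ^ 2 * (n₂ * q)) := by
  lift a to ℝ≥0 using ha
  lift b to ℝ≥0 using hb
  lift p to ℝ≥0 using hp
  lift q to ℝ≥0 using hq
  simp only [ENNReal.ofReal_coe_nnreal]
  norm_cast
  rw [ENNReal.ofReal_coe_nnreal]

/-- On bounded sets a higher power of δ is dominated by a lower one, so all exponents reduce to the
smallest. -/
lemma rpow_le_rpow_mul_rpow {δ M a γ : ℝ} (hδ : 0 ≤ δ) (hδM : δ ≤ M) (hM : 1 ≤ M) (hγ : 0 ≤ γ)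
    (hγa : γ ≤ a) : δ ^ a ≤ M ^ a * δ ^ γ := by
  calc δ ^ a = δ ^ (a - γ) * δ ^ γ := by
        rw [← Real.rpow_add_of_nonneg hδ (sub_nonneg.2 hγa) hγ, sub_add_cancel]
    _ ≤ M ^ (a - γ) * δ ^ γ := by gcongr
    _ ≤ M ^ a * δ ^ γ := by gcongr; linarith

/-- The time part is at most √(2R), which is below 2R because R ≥ 1. -/
lemma pdist_le_of_mem_closedBall {R : ℝ} (hR : 1 ≤ R) {X Y : SpaceTime d}
    (hX : X ∈ Metric.closedBall (0 : SpaceTime d) R)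
    (hY : Y ∈ Metric.closedBall (0 : SpaceTime d) R) : pdist X Y ≤ 2 * R := by
  rw [mem_closedBall_zero_iff, Prod.norm_def, max_le_iff, Real.norm_eq_abs] at hX hY
  refine max_le ((norm_sub_le _ _).trans (by linarith [hX.2, hY.2])) ?_
  refine Real.sqrt_le_iff.2 ⟨by linarith, (abs_sub _ _).trans ?_⟩
  nlinarith [hX.1, hY.1]

/-- Hölder continuity in `L²(0, t)` of the integrand of the stochastic convolution. -/
lemma exists_eLpNorm_innerConv_sub_le (d : ℕ) (T : ℝ≥0∞) {β γ₁ γ₂ : ℝ} (hβ : 0 < β) (hβ' : β ≤ 1)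
    (hγ₁ : 0 < γ₁) (hγ₂ : 0 < γ₂) (N₀ N₁ N₂ Cg : ℝ≥0) {R : ℝ} (hR : 1 ≤ R) :
    ∃ C : ℝ≥0, ∀ (K g : SpaceTime d → ℝ), Measurable K → KernelBounds T β γ₁ γ₂ N₀ N₁ N₂ K →
      IsPHolderWith Cg β g → g (0, 0) = 0 →
      ∀ X ∈ timeStrip d T ∩ Metric.closedBall 0 R, ∀ Y ∈ timeStrip d T ∩ Metric.closedBall 0 R,
        Y.1 ≤ X.1 →
        eLpNorm (fun r ↦ innerConv K g X r - (Ioc 0 Y.1).indicator (innerConv K g Y) r) 2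
            (volume.restrict (Ioc 0 X.1)) ≤
          C * ENNReal.ofReal (pdist X Y ^ min (min γ₁ γ₂) β) := by
  set γ := min (min γ₁ γ₂) β
  have hγ0 : 0 < γ := lt_min (lt_min hγ₁ hγ₂) hβ
  have hγγ₁ : γ ≤ γ₁ := (min_le_left _ _).trans (min_le_left _ _)
  have hγγ₂ : γ ≤ γ₂ := (min_le_left _ _).trans (min_le_right _ _)
  have hγβ : γ ≤ β := min_le_right _ _
  set M := 2 * R
  have hM : 1 ≤ M := by simp only [M]; linarith
  -- The terms come from the kernel increment, the increment of g and the last interval; the factors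
  -- 2 come from (a + b)² ≤ 2(a² + b²).
  set c : ℝ := 2 * ((Cg * R ^ β) ^ 2 * (N₁ * M ^ (2 * γ₁))) +
    2 * ((Cg * M ^ β) ^ 2 * N₀) + (Cg * R ^ β) ^ 2 * (N₂ * M ^ (2 * γ₂)) with hc
  have hc0 : 0 ≤ c := by positivity
  refine ⟨(Real.sqrt c).toNNReal, fun K g hK hB hg hg0 X hX Y hY hYX ↦ ?_⟩
  have hδ0 := pdist_nonneg X Y
  have hδM : pdist X Y ≤ M := pdist_le_of_mem_closedBall hR hX.2 hY.2
  have hXR := hX.2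
  rw [mem_closedBall_zero_iff, Prod.norm_def, max_le_iff, Real.norm_eq_abs] at hXR
  have hX₁ : X.1 ≤ R := (le_abs_self _).trans hXR.1
  -- Parabolic scaling: |t - s| ≤ δ² doubles the time exponent, which matches δ^(2γ) in the squared
  -- norm.
  have htime : ∀ a, γ ≤ a → (X.1 - Y.1) ^ a ≤ M ^ (2 * a) * pdist X Y ^ (2 * γ) := fun a ha ↦ by
    have hXY : 0 ≤ X.1 - Y.1 := sub_nonneg.2 hYX
    calc (X.1 - Y.1) ^ a ≤ (pdist X Y ^ 2) ^ a := by
          refine Real.rpow_le_rpow hXY ?_ (hγ0.le.trans ha)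
          exact (le_abs_self _).trans (abs_sub_le_pdist_sq X Y)
      _ = pdist X Y ^ (2 * a) := by rw [← Real.rpow_natCast_mul hδ0]; norm_num
      _ ≤ _ := rpow_le_rpow_mul_rpow hδ0 hδM hM (by positivity) (by linarith)
  have hspace : ‖X.2 - Y.2‖ ^ β ≤ M ^ β * pdist X Y ^ γ :=
    (Real.rpow_le_rpow (norm_nonneg _) (norm_sub_le_pdist X Y) hβ.le).trans
      (rpow_le_rpow_mul_rpow hδ0 hδM hM hγ0.le hγβ)
  have hsq : pdist X Y ^ (2 * γ) = (pdist X Y ^ γ) ^ 2 := by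
    rw [mul_comm, ← Real.rpow_mul_natCast hδ0]; norm_num
  have hN : ∀ n : ℝ≥0, (n : ℝ≥0∞) = ENNReal.ofReal n := fun n ↦
    (ENNReal.ofReal_coe_nnreal).symm
  have hbound : ∫⁻ r in Ioc 0 X.1,
      ‖innerConv K g X r - (Ioc 0 Y.1).indicator (innerConv K g Y) r‖ₑ ^ 2 ≤
        ENNReal.ofReal (c * pdist X Y ^ (2 * γ)) := by
    rw [lintegral_sub_indicator_sq hY.1.1.le hYX]
    refine (add_le_add (lintegral_innerConv_sub_sq_le hK hB hg hg0 hβ hβ' hR hX.1 hY.1 hYX hX₁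
      hXR.2) (lintegral_innerConv_sq_le hB hg hg0 hβ hβ' hR hX.1.2.le hX₁ hXR.2 hY.1.1.le
      hYX)).trans ?_
    have hXY : 0 ≤ X.1 - Y.1 := sub_nonneg.2 hYX
    have h1 := Real.rpow_nonneg hXY γ₁
    have h2 := Real.rpow_nonneg hXY γ₂
    have h3 : 0 ≤ (Cg : ℝ) * ‖X.2 - Y.2‖ ^ β := by positivity
    have h4 : 0 ≤ (Cg : ℝ) * R ^ β := by positivity
    rw [ennreal_combination_eq_ofReal N₀ N₁ N₂ h4 h3 h1 h2]
    refine ENNReal.ofReal_le_ofReal ?_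
    calc _ ≤ 2 * ((Cg * R ^ β) ^ 2 * (N₁ * (M ^ (2 * γ₁) * pdist X Y ^ (2 * γ)))) +
          2 * ((Cg * (M ^ β * pdist X Y ^ γ)) ^ 2 * N₀) +
          (Cg * R ^ β) ^ 2 * (N₂ * (M ^ (2 * γ₂) * pdist X Y ^ (2 * γ))) := by
          gcongr
          · exact htime _ hγγ₁
          · exact htime _ hγγ₂
      _ = _ := by rw [hc, hsq]; ring
  rw [eLpNorm_eq_lintegral_rpow_enorm_toReal two_ne_zero ENNReal.ofNat_ne_top]
  simp only [ENNReal.toReal_ofNat, ENNReal.rpow_ofNat]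
  calc _ ≤ ENNReal.ofReal (c * pdist X Y ^ (2 * γ)) ^ (1 / 2 : ℝ) := by gcongr
    _ = _ := by
      rw [ENNReal.ofReal_rpow_of_nonneg (by positivity) (by norm_num), hN,
        Real.coe_toNNReal _ (Real.sqrt_nonneg _), ← ENNReal.ofReal_mul (Real.sqrt_nonneg _),
        ← Real.sqrt_eq_rpow, Real.sqrt_mul hc0, hsq, Real.sqrt_sq (by positivity)]

end InnerConvolution

/-! ### Parabolic geometry and the Campanato bound -/

section Campanato

variable {d : ℕ}

lemma pdist_triangle (X Y Z : SpaceTime d) : pdist X Z ≤ pdist X Y + pdist Y Z := by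
  have h1 := pdist_nonneg X Y
  have h2 := pdist_nonneg Y Z
  refine max_le ?_ (Real.sqrt_le_iff.2 ⟨by positivity, ?_⟩)
  · exact (norm_sub_le_norm_sub_add_norm_sub _ _ _).trans
      (add_le_add (norm_sub_le_pdist _ _) (norm_sub_le_pdist _ _))
  · have := abs_sub_le X.1 Y.1 Z.1
    nlinarith [abs_sub_le_pdist_sq X Y, abs_sub_le_pdist_sq Y Z]

lemma pball_eq_prod (X : SpaceTime d) {c : ℝ} (hc : 0 < c) :
    pball X c = Metric.ball X.1 (c ^ 2) ×ˢ Metric.ball X.2 c := by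
  ext Y
  simp only [pball, pdist, mem_ofPred_eq, max_lt_iff, mem_prod, Metric.mem_ball, dist_comm Y.1,
    dist_comm Y.2, dist_eq_norm, Real.sqrt_lt' hc]
  exact and_comm

lemma measurableSet_pball (X : SpaceTime d) (c : ℝ) : MeasurableSet (pball X c) :=
  measurableSet_lt (continuous_pdist.comp (by fun_prop : Continuous fun Y ↦ (X, Y))).measurable
    measurable_const

/-- The ball is a time interval of half-length c² times a Euclidean ball of radius c, hence the
homogeneous dimension d + 2. -/
lemma volume_pball (X : SpaceTime d) {c : ℝ} (hc : 0 < c) :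
    volume (pball X c) = ENNReal.ofReal (c ^ (d + 2)) *
      (2 * volume (Metric.ball (0 : EuclideanSpace ℝ (Fin d)) 1)) := by
  rw [pball_eq_prod X hc, Measure.volume_eq_prod, Measure.prod_prod, Real.volume_ball,
    Measure.addHaar_ball_of_pos _ _ hc, finrank_euclideanSpace, Fintype.card_fin,
    ENNReal.ofReal_mul two_pos.le, ENNReal.ofReal_ofNat, pow_add,
    ENNReal.ofReal_mul (by positivity)]
  ring

lemma pdist_le_pdiam {D : Set (SpaceTime d)} {X Y : SpaceTime d} (hX : X ∈ D) (hY : Y ∈ D) :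
    ENNReal.ofReal (pdist X Y) ≤ pdiam D :=
  (le_iSup₂_of_le Y hY le_rfl).trans
    (le_iSup₂ (f := fun X (_ : X ∈ D) ↦ ⨆ Y ∈ D, ENNReal.ofReal (pdist X Y)) X hX)

/-- The second point is obtained by a shift in time, which works even when d = 0. -/
lemma pdiam_pos {D : Set (SpaceTime d)} (hD : IsOpen D) {X : SpaceTime d} (hX : X ∈ D) :
    0 < pdiam D := by
  have hc : Continuous fun ε : ℝ ↦ ((X.1 + ε, X.2) : SpaceTime d) := by fun_prop
  have h0 : ∀ᶠ ε in 𝓝[>] (0 : ℝ), ((X.1 + ε, X.2) : SpaceTime d) ∈ D :=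
    (hc.tendsto 0).mono_left nhdsWithin_le_nhds (hD.mem_nhds (by simpa using hX))
  obtain ⟨ε, hε, hε0⟩ := (h0.and self_mem_nhdsWithin).exists
  refine lt_of_lt_of_le ?_ (pdist_le_pdiam hX hε)
  have h1 : 0 < |ε| := abs_pos.2 (ne_of_gt hε0)
  simp [pdist, h1]

lemma pdiam_ne_top {D : Set (SpaceTime d)} {R : ℝ} (hR : 1 ≤ R)
    (hD : D ⊆ Metric.closedBall 0 R) : pdiam D ≠ ∞ := by
  refine ne_top_of_le_ne_top (ENNReal.ofReal_ne_top (r := 2 * R)) ?_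
  exact iSup₂_le fun X hX ↦ iSup₂_le fun Y hY ↦
    ENNReal.ofReal_le_ofReal (pdist_le_of_mem_closedBall hR (hD hX) (hD hY))

/-- On an `A`-type set, `D ∩ Q_c(X)` has diameter at most `2 ρ` for a radius `ρ` whose parabolic
ball is comparable in measure with `D ∩ Q_c(X)`. -/
lemma IsATypeWith.exists_radius {A : ℝ≥0} {D : Set (SpaceTime d)} (hA : IsATypeWith A D)
    (hD : IsOpen D) {R : ℝ} (hR : 1 ≤ R) (hDR : D ⊆ Metric.closedBall 0 R) {X : SpaceTime d}
    (hX : X ∈ D) {c : ℝ} (hc : 0 < c) :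
    ∃ ρ : ℝ, 0 < ρ ∧ A * volume (pball X ρ) ≤ volume (D ∩ pball X c) ∧
      ∀ Y ∈ D ∩ pball X c, ∀ Z ∈ D ∩ pball X c, pdist Y Z ≤ 2 * ρ := by
  have htop := pdiam_ne_top hR hDR
  have hpos : 0 < (pdiam D).toReal := ENNReal.toReal_pos (pdiam_pos hD hX).ne' htop
  -- The A-type bound reaches only up to diam D. For larger c the diameter of D itself bounds all
  -- distances.
  refine ⟨min c (pdiam D).toReal, lt_min hc hpos, ?_, fun Y hY Z hZ ↦ ?_⟩
  · refine (hA.2 X hX _ (lt_min hc hpos) ?_).trans ?_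
    · exact ENNReal.ofReal_le_of_le_toReal (min_le_right _ _)
    · refine measure_mono (inter_subset_inter_right _ fun Y hY ↦ ?_)
      exact lt_of_lt_of_le (show pdist X Y < _ from hY) (min_le_left _ _)
  · rw [mul_min_of_nonneg _ _ zero_le_two]
    refine le_min ?_ ?_
    · have h1 : pdist X Y < c := hY.2
      have h2 : pdist X Z < c := hZ.2
      have h3 := pdist_triangle Y X Z
      rw [pdist_comm Y X] at h3
      linarith
    · have := (ENNReal.ofReal_le_iff_le_toReal htop).1 (pdist_le_pdiam hY.1 hZ.1)
      linarith

variable {Ω : Type*} [MeasurableSpace Ω] {P : Measure Ω}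

lemma lintegral_lintegral_lintegral_le [SFinite P] {u : SpaceTime d → Ω → ℝ} {p : ℝ}
    (hu : Measurable (fun q : SpaceTime d × Ω ↦ u q.1 q.2)) {Q : Set (SpaceTime d)}
    (hQ : MeasurableSet Q) {B : ℝ≥0∞}
    (hB : ∀ Y ∈ Q, ∀ Z ∈ Q, ∫⁻ ω, ‖u Y ω - u Z ω‖ₑ ^ p ∂P ≤ B) :
    ∫⁻ ω, (∫⁻ Y in Q, ∫⁻ Z in Q, ‖u Y ω - u Z ω‖ₑ ^ p) ∂P ≤ B * volume Q ^ 2 := by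
  have hm : Measurable fun q : (Ω × SpaceTime d) × SpaceTime d ↦
      ‖u q.1.2 q.1.1 - u q.2 q.1.1‖ₑ ^ p := by
    refine ((Measurable.sub ?_ ?_).enorm).pow_const p
    · exact hu.comp (f := fun q : (Ω × SpaceTime d) × SpaceTime d ↦ (q.1.2, q.1.1)) (by fun_prop)
    · exact hu.comp (f := fun q : (Ω × SpaceTime d) × SpaceTime d ↦ (q.2, q.1.1)) (by fun_prop)
  rw [lintegral_lintegral_swap (f := fun ω Y ↦ ∫⁻ Z in Q, ‖u Y ω - u Z ω‖ₑ ^ p)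
    hm.lintegral_prod_right'.aemeasurable]
  calc _ = ∫⁻ Y in Q, ∫⁻ Z in Q, ∫⁻ ω, ‖u Y ω - u Z ω‖ₑ ^ p ∂P := by
        refine lintegral_congr fun Y ↦ ?_
        exact lintegral_lintegral_swap (f := fun ω Z ↦ ‖u Y ω - u Z ω‖ₑ ^ p) (hm.comp
          (f := fun q : Ω × SpaceTime d ↦ ((q.1, Y), q.2)) (by fun_prop)).aemeasurable
    _ ≤ ∫⁻ Y in Q, ∫⁻ Z in Q, B :=
        setLIntegral_mono' hQ fun Y hY ↦ setLIntegral_mono' hQ fun Z hZ ↦ hB Y hY Z hZ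
    _ = B * volume Q ^ 2 := by
        simp [sq, mul_assoc]

/-- Kolmogorov-type moment bounds on an `A`-type domain give a Campanato bound. -/
lemma campanatoSeminorm_le [SFinite P] {A : ℝ≥0} {D : Set (SpaceTime d)} (hA : IsATypeWith A D)
    (hD : IsOpen D) {R : ℝ} (hR : 1 ≤ R) (hDR : D ⊆ Metric.closedBall 0 R)
    {u : SpaceTime d → Ω → ℝ} (hu : Measurable (fun q : SpaceTime d × Ω ↦ u q.1 q.2))
    {p γ : ℝ} (hp : 0 < p) (hγ : 0 ≤ γ) {C : ℝ≥0∞}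
    (hC : ∀ Y ∈ D, ∀ Z ∈ D,
      ∫⁻ ω, ‖u Y ω - u Z ω‖ₑ ^ p ∂P ≤ C * ENNReal.ofReal (pdist Y Z) ^ (γ * p)) :
    campanatoSeminorm p (1 + γ * p / ((d : ℝ) + 2)) D P u ≤
      (C * 2 ^ (γ * p) * ((A * (2 * volume (Metric.ball (0 : EuclideanSpace ℝ (Fin d)) 1)))⁻¹) ^
        (γ * p / ((d : ℝ) + 2))) ^ (1 / p) := by
  set κ := 2 * volume (Metric.ball (0 : EuclideanSpace ℝ (Fin d)) 1)
  have hκ0 : κ ≠ 0 := mul_ne_zero two_ne_zero (Metric.measure_ball_pos _ _ one_pos).ne'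
  have hκt : κ ≠ ∞ := ENNReal.mul_ne_top (by simp) measure_ball_lt_top.ne
  have hA0 : (A : ℝ≥0∞) ≠ 0 := by exact_mod_cast hA.1.ne'
  have hAκ0 : A * κ ≠ 0 := mul_ne_zero hA0 hκ0
  have hAκt : A * κ ≠ ∞ := ENNReal.mul_ne_top ENNReal.coe_ne_top hκt
  set a := γ * p / ((d : ℝ) + 2) with ha
  have ha0 : 0 ≤ a := by positivity
  rw [campanatoSeminorm]
  gcongr
  refine iSup₂_le fun X hX ↦ iSup₂_le fun c hc ↦ ?_
  obtain ⟨ρ, hρ, hvol, hdiam⟩ := hA.exists_radius hD hR hDR hX hc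
  set Q := D ∩ pball X c
  have hρ0 : ENNReal.ofReal ρ ≠ 0 := by simpa using hρ
  rw [volume_pball X hρ, ENNReal.ofReal_pow hρ.le] at hvol
  -- The A-type bound makes |Q| positive, which the division by a power of |Q| requires.
  have hQ0 : volume Q ≠ 0 := fun h ↦ by
    rw [h, nonpos_iff_eq_zero] at hvol
    exact mul_ne_zero hA0 (mul_ne_zero (pow_ne_zero _ hρ0) hκ0) hvol
  have hQt : volume Q ≠ ∞ := by
    refine measure_ne_top_of_subset (inter_subset_right) ?_
    rw [volume_pball X hc]
    exact ENNReal.mul_ne_top ENNReal.ofReal_ne_top hκt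
  have hρQ : ENNReal.ofReal ρ ^ (d + 2) ≤ (A * κ)⁻¹ * volume Q := by
    rw [← ENNReal.div_eq_inv_mul, ENNReal.le_div_iff_mul_le (Or.inl hAκ0) (Or.inl hAκt)]
    calc _ = A * (ENNReal.ofReal ρ ^ (d + 2) * κ) := by ring
      _ ≤ _ := hvol
  have hρa : ENNReal.ofReal ρ ^ (γ * p) ≤ ((A * κ)⁻¹) ^ a * volume Q ^ a := by
    rw [← ENNReal.mul_rpow_of_nonneg _ _ ha0]
    refine le_trans (le_of_eq ?_) (ENNReal.rpow_le_rpow hρQ ha0)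
    rw [← ENNReal.rpow_natCast, ← ENNReal.rpow_mul]
    congr 1
    rw [ha]
    push_cast
    field_simp
  -- In 1 + θ = 2 + a the 2 pays for the double integral and a for the oscillation.
  have hpow : volume Q ^ (1 + (1 + a)) = volume Q ^ a * volume Q ^ 2 := by
    rw [← ENNReal.rpow_natCast, ← ENNReal.rpow_add _ _ hQ0 hQt]
    congr 1
    push_cast
    ring
  have h0 : volume Q ^ (1 + (1 + a)) ≠ 0 := (ENNReal.rpow_pos (pos_iff_ne_zero.2 hQ0) hQt).ne'
  have ht : volume Q ^ (1 + (1 + a)) ≠ ∞ := ENNReal.rpow_ne_top_of_nonneg (by positivity) hQt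
  rw [ENNReal.div_le_iff h0 ht]
  calc _ ≤ C * ENNReal.ofReal (2 * ρ) ^ (γ * p) * volume Q ^ 2 := by
        refine lintegral_lintegral_lintegral_le hu (hD.measurableSet.inter (measurableSet_pball X c))
          fun Y hY Z hZ ↦ (hC Y hY.1 Z hZ.1).trans ?_
        gcongr
        exact hdiam Y hY Z hZ
    _ ≤ C * (2 ^ (γ * p) * (((A * κ)⁻¹) ^ a * volume Q ^ a)) * volume Q ^ 2 := by
        rw [ENNReal.ofReal_mul zero_le_two, ENNReal.ofReal_ofNat,
          ENNReal.mul_rpow_of_nonneg _ _ (by positivity)]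
        gcongr
    _ = _ := by rw [hpow]; ring

end Campanato

/-! ### The stochastic convolution: regularity and existence -/

lemma IsWienerIntegral.congr {Ω : Type*} [MeasurableSpace Ω] {P : Measure Ω}
    {W : ℝ≥0 → Ω → ℝ} {t : ℝ} {f : ℝ → ℝ} {ξ η : Ω → ℝ} (h : IsWienerIntegral W P t f ξ)
    (hξη : ξ =ᵐ[P] η) : IsWienerIntegral W P t f η := by
  obtain ⟨hf, hξ, F, hF, hFξ⟩ := h
  refine ⟨hf, hξ.ae_eq hξη, F, hF, hFξ.congr fun n ↦ eLpNorm_congr_ae ?_⟩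
  filter_upwards [hξη] with ω hω
  rw [hω]

lemma isOpen_timeStrip (d : ℕ) (T : ℝ≥0∞) : IsOpen (timeStrip d T) :=
  (isOpen_lt continuous_const continuous_fst).inter
    (isOpen_lt (ENNReal.continuous_ofReal.comp continuous_fst) continuous_const)

/-- Hölder continuity of the stochastic convolution in `L^q(Ω)`. -/
lemma exists_eLpNorm_convolution_sub_le (d : ℕ) (T : ℝ≥0∞) {β γ₁ γ₂ : ℝ} (hβ : 0 < β)
    (hβ' : β ≤ 1) (hγ₁ : 0 < γ₁) (hγ₂ : 0 < γ₂) (N₀ N₁ N₂ Cg : ℝ≥0) {R : ℝ} (hR : 1 ≤ R)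
    {q : ℝ≥0∞} (hq : q ≠ ∞) :
    ∃ C : ℝ≥0, ∀ (K g : SpaceTime d → ℝ), Measurable K → KernelBounds T β γ₁ γ₂ N₀ N₁ N₂ K →
      IsPHolderWith Cg β g → g (0, 0) = 0 →
      ∀ {Ω : Type*} [MeasurableSpace Ω] (P : Measure Ω) [IsProbabilityMeasure P]
        (W : ℝ≥0 → Ω → ℝ), IsWienerProcess T W P → ∀ ξ : SpaceTime d → Ω → ℝ,
        (∀ X ∈ timeStrip d T, IsWienerIntegral W P X.1 (innerConv K g X) (ξ X)) →
        ∀ X ∈ timeStrip d T ∩ Metric.closedBall 0 R, ∀ Y ∈ timeStrip d T ∩ Metric.closedBall 0 R,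
          eLpNorm (fun ω ↦ ξ X ω - ξ Y ω) q P ≤
            C * ENNReal.ofReal (pdist X Y ^ min (min γ₁ γ₂) β) := by
  obtain ⟨C, hC⟩ :=
    exists_eLpNorm_innerConv_sub_le d T hβ hβ' hγ₁ hγ₂ N₀ N₁ N₂ Cg hR
  set m := eLpNorm id q (gaussianReal 0 1)
  have hm : m ≠ ∞ := eLpNorm_id_gaussianReal_ne_top hq
  refine ⟨m.toNNReal * C, fun K g hK hB hg hg0 Ω _ P _ W hW ξ hξ X hX Y hY ↦ ?_⟩
  rw [ENNReal.coe_mul, ENNReal.coe_toNNReal hm, mul_assoc]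
  wlog hYX : Y.1 ≤ X.1 generalizing X Y
  · have h : eLpNorm (fun ω ↦ ξ X ω - ξ Y ω) q P = eLpNorm (fun ω ↦ ξ Y ω - ξ X ω) q P :=
      eLpNorm_sub_comm (ξ X) (ξ Y) q P
    rw [h, pdist_comm]
    exact this Y hY X hX (le_of_not_ge hYX)
  refine ((IsWienerIntegral.sub_indicator hW hYX hX.1.2.le (hξ X hX.1) (hξ Y hY.1)).eLpNorm_le hW
    hX.1.2.le hq).trans ?_
  gcongr
  exact hC K g hK hB hg hg0 X hX Y hY hYX

/-- Integrals chosen separately at each X need not be jointly measurable. The Hölder bound with q =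
2 makes the choice continuous into L²(Ω), and replacing it by a jointly measurable version alters
each value only on a null set. -/
lemma exists_isStochasticConvolution {d : ℕ} {T : ℝ≥0∞} {β γ₁ γ₂ : ℝ} (hβ : 0 < β)
    (hβ' : β ≤ 1) (hγ₁ : 0 < γ₁) (hγ₂ : 0 < γ₂) {N₀ N₁ N₂ Cg : ℝ≥0} {K g : SpaceTime d → ℝ}
    (hK : Measurable K) (hB : KernelBounds T β γ₁ γ₂ N₀ N₁ N₂ K) (hg : IsPHolderWith Cg β g)
    (hg0 : g (0, 0) = 0) {Ω : Type*} [MeasurableSpace Ω] {P : Measure Ω} [IsProbabilityMeasure P]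
    {W : ℝ≥0 → Ω → ℝ} (hW : IsWienerProcess T W P) :
    ∃ u : SpaceTime d → Ω → ℝ, IsStochasticConvolution T K g W P u := by
  have hex : ∀ X : SpaceTime d, ∃ ξ : Ω → ℝ, X ∈ timeStrip d T →
      IsWienerIntegral W P X.1 (innerConv K g X) ξ := fun X ↦ by
    by_cases hX : X ∈ timeStrip d T
    · obtain ⟨ξ, hξ⟩ := exists_isWienerIntegral hW hX.2.le (memLp_innerConv hK hB hg hg0 hβ hβ' hX)
      exact ⟨ξ, fun _ ↦ hξ⟩
    · exact ⟨0, fun h ↦ absurd h hX⟩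
  choose ξ hξ using hex
  set f : timeStrip d T → Lp ℝ 2 P := fun X ↦ (hξ X X.2).2.1.toLp (ξ X)
  have hf : Continuous f := by
    rw [continuous_iff_continuousAt]
    intro X
    -- The Hölder constant depends on the ball, but continuity at X needs only one ball containing a
    -- neighbourhood of X.
    set R := ‖(X : SpaceTime d)‖ + 1
    have hR : 1 ≤ R := le_add_of_nonneg_left (norm_nonneg _)
    obtain ⟨C, hC⟩ := exists_eLpNorm_convolution_sub_le d T hβ hβ' hγ₁ hγ₂ N₀ N₁ N₂ Cg hR
      (ENNReal.ofNat_ne_top (n := 2))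
    rw [ContinuousAt, tendsto_iff_edist_tendsto_0]
    have hev : ∀ᶠ Y : timeStrip d T in 𝓝 X,
        edist (f Y) (f X) ≤ C * ENNReal.ofReal (pdist (Y : SpaceTime d) X ^ min (min γ₁ γ₂) β) := by
      have hnear : ∀ᶠ Y : timeStrip d T in 𝓝 X, ‖(Y : SpaceTime d)‖ < R :=
        (continuous_subtype_val.norm.tendsto X).eventually_lt_const (lt_add_one _)
      filter_upwards [hnear] with Y hY
      rw [Lp.edist_toLp_toLp]
      exact hC K g hK hB hg hg0 P W hW ξ hξ Y ⟨Y.2, by simpa using hY.le⟩ X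
        ⟨X.2, by simp [R]⟩
    refine tendsto_of_tendsto_of_tendsto_of_le_of_le' tendsto_const_nhds ?_
      (Eventually.of_forall fun _ ↦ zero_le) hev
    have hc : Continuous fun Y : timeStrip d T ↦
        ENNReal.ofReal (pdist (Y : SpaceTime d) X ^ min (min γ₁ γ₂) β) := by
      refine ENNReal.continuous_ofReal.comp (Continuous.rpow_const ?_ fun _ ↦ Or.inr ?_)
      · exact continuous_pdist.comp
          (f := fun Y : timeStrip d T ↦ ((Y : SpaceTime d), (X : SpaceTime d))) (by fun_prop)
      · exact (lt_min (lt_min hγ₁ hγ₂) hβ).le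
    have h0 := ENNReal.Tendsto.const_mul (a := (C : ℝ≥0∞)) (hc.tendsto X)
      (Or.inr ENNReal.coe_ne_top)
    rwa [pdist_self, Real.zero_rpow (lt_min (lt_min hγ₁ hγ₂) hβ).ne', ENNReal.ofReal_zero,
      mul_zero] at h0
  -- The strip is open, hence measurable, so the map extends strongly measurably to all of
  -- space-time; its values outside are irrelevant.
  obtain ⟨F, hF, hFf⟩ := (MeasurableEmbedding.subtype_coe
    (isOpen_timeStrip d T).measurableSet).exists_stronglyMeasurable_extend
      hf.stronglyMeasurable fun _ ↦ inferInstance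
  obtain ⟨u, hu, huF⟩ := exists_measurable_version hF
  refine ⟨u, hu, fun X hX ↦ ae_integrable_innerConv hK hB hg hg0 hβ hβ' hX, fun X hX ↦ ?_⟩
  refine (hξ X hX).congr ?_
  have h1 : F X = f ⟨X, hX⟩ := congrFun hFf ⟨X, hX⟩
  have h2 := huF X
  rw [h1] at h2
  exact (h2.trans (MemLp.coeFn_toLp _)).symm

end StochConv

/-! ### The main theorem -/

theorem theorem2p1 (d : ℕ) (T : ℝ≥0∞) (hT : 0 < T) (p : ℝ) (hp : 1 ≤ p)
    (β γ₁ γ₂ : ℝ) (hβ₀ : 0 < β) (hβ₁ : β < 1) (hγ₁ : 0 < γ₁) (hγ₂ : 0 < γ₂)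
    (N₀ N₁ N₂ Cg A : ℝ≥0) (R : ℝ) :
    ∃ N : ℝ≥0, ∀ (K g : SpaceTime d → ℝ),
      Measurable K → KernelBounds T β γ₁ γ₂ N₀ N₁ N₂ K →
      IsPHolderWith Cg β g → g (0, 0) = 0 →
      ∀ (Ω : Type*) [MeasurableSpace Ω] (P : Measure Ω) [IsProbabilityMeasure P]
        (W : ℝ≥0 → Ω → ℝ), IsWienerProcess T W P →
        (∃ u : SpaceTime d → Ω → ℝ, IsStochasticConvolution T K g W P u) ∧
        ∀ u : SpaceTime d → Ω → ℝ, IsStochasticConvolution T K g W P u →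
          ∀ D : Set (SpaceTime d), IsOpen D → IsConnected D →
            D ⊆ Metric.closedBall 0 R → closure D ⊆ timeStrip d T → IsATypeWith A D →
            campanatoSeminorm p (1 + min (min γ₁ γ₂) β * p / ((d : ℝ) + 2)) D P u ≤ N := by
  have hp0 : 0 < p := one_pos.trans_le hp
  have hγ : 0 < min (min γ₁ γ₂) β := lt_min (lt_min hγ₁ hγ₂) hβ₀
  set γ := min (min γ₁ γ₂) β
  -- The estimates assume a radius at least 1; enlarging R to max 1 R is harmless.
  obtain ⟨C, hC⟩ := exists_eLpNorm_convolution_sub_le d T hβ₀ hβ₁.le hγ₁ hγ₂ N₀ N₁ N₂ Cg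
    (le_max_left 1 R) (ENNReal.ofReal_ne_top (r := p))
  set κ := 2 * volume (Metric.ball (0 : EuclideanSpace ℝ (Fin d)) 1)
  set N : ℝ≥0∞ := (C ^ p * 2 ^ (γ * p) * ((A * κ)⁻¹) ^ (γ * p / ((d : ℝ) + 2))) ^ (1 / p)
  -- If A = 0, N may be ∞ and `toNNReal` returns the default 0; this does no harm, as `IsATypeWith`
  -- includes 0 < A.
  refine ⟨N.toNNReal, fun K g hK hB hg hg0 Ω _ P _ W hW ↦
    ⟨exists_isStochasticConvolution hβ₀ hβ₁.le hγ₁ hγ₂ hK hB hg hg0 hW,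
      fun u hu D hD _ hDR hDT hA ↦ ?_⟩⟩
  have hDR' : D ⊆ Metric.closedBall 0 (max 1 R) :=
    hDR.trans (Metric.closedBall_subset_closedBall (le_max_right _ _))
  have hDs : D ⊆ timeStrip d T := subset_closure.trans hDT
  have hκ0 : κ ≠ 0 := mul_ne_zero two_ne_zero (Metric.measure_ball_pos _ _ one_pos).ne'
  have hN : N ≠ ∞ := by
    refine ENNReal.rpow_ne_top_of_nonneg (by positivity) (ENNReal.mul_ne_top (ENNReal.mul_ne_top
      (ENNReal.rpow_ne_top_of_nonneg hp0.le ENNReal.coe_ne_top)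
      (ENNReal.rpow_ne_top_of_nonneg (by positivity) (by simp)))
      (ENNReal.rpow_ne_top_of_nonneg (by positivity) ?_))
    exact ENNReal.inv_ne_top.2 (mul_ne_zero (by exact_mod_cast hA.1.ne') hκ0)
  rw [ENNReal.coe_toNNReal hN]
  refine campanatoSeminorm_le hA hD (le_max_left 1 R) hDR' hu.measurable hp0 hγ.le
    fun Y hY Z hZ ↦ ?_
  have h := hC K g hK hB hg hg0 P W hW u hu.version Y ⟨hDs hY, hDR' hY⟩ Z ⟨hDs hZ, hDR' hZ⟩
  have hp' : ENNReal.ofReal p ≠ 0 := by simpa using hp0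
  rw [eLpNorm_eq_lintegral_rpow_enorm_toReal hp' ENNReal.ofReal_ne_top,
    ENNReal.toReal_ofReal hp0.le, one_div, ENNReal.rpow_inv_le_iff hp0,
    ENNReal.mul_rpow_of_nonneg _ _ hp0.le,
    ← ENNReal.ofReal_rpow_of_nonneg (pdist_nonneg _ _) hγ.le, ← ENNReal.rpow_mul] at h
  exact h
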